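/- For integers $n\ge 1$, $d\ge 3$ let $\mathcal G(n,d)$ be the random bipartite graph with sides $V_1,V_2$ of size $n$ each that is the union of $d$ independent, uniformly random perfect matchings between $V_1$ and $V_2$ (parallel edges are allowed; they may be merged without changing anything below). For a finite graph $G$ and $\lambda>0$, the hard-core distribution $\mu_{G,\lambda}$ gives each independent set $I$ of $G$ probability proportional to $\lambda^{|I|}$. The Glauber dynamics is the following Markov chain on the independent sets: from $I$, choose a vertex $v$ uniformly at random; if no neighbour of $v$ is in $I$, make $v$ occupied with probability $\lambda/(\lambda+1)$ and unoccupied otherwise; if some neighbour of $v$ is in $I$, make $v$ unoccupied. The mixing time $T_{\mathrm{mix}}(P)\in\mathbb N\cup\{\infty\}$ of a chain $P$ with stationary distribution $\mu_{G,\lambda}$ is the least $t$ such that from every starting state the law after $t$ steps is within total variation distance $1/(2e)$ of $\mu_{G,\lambda}$. Let $\lambda_c(d)=(d-1)^{d-1}/(d-2)^d$. **Theorem.** For every $d\ge 3$ there is $\varepsilon_d>0$ such that for every $\lambda$ with $\lambda_c(d)<\lambda<\lambda_c(d)+\varepsilon_d$ there are $a=a(\lambda,d)>1$ and $c=c(\lambda,d)>0$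 with the following properties. 1. With probability tending to $1$ as $n\to\infty$, the mixing time of the Glauber dynamics on $G\sim\mathcal G(n,d)$ is at least $c\,a^n$. 2. For every $k:\mathbb N\to\mathbb N$ with $k(n)=o(n)$, with probability tending to $1$ as $n\to\infty$, the graph $G\sim\mathcal G(n,d)$ is such that every Markov chain on its independent sets that is reversible with respect to $\mu_{G,\lambda}$ and changes the state of at most $k(n)$ vertices in each step (i.e. $P(I,J)>0$ implies $|I\,\triangle\,J|\le k(n)$) has mixing time at least $c\,a^n$. -/

import Mathlib

open Filter Topology Asymptotics

noncomputable section

namespace HardCore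

/-! ### Finite Markov chains -/

section Chains

variable {S : Type*} [Fintype S] [DecidableEq S]

/-- Total variation distance between two probability vectors on a finite set. -/
def tvDist (p q : S → ℝ) : ℝ := (1 / 2) * ∑ x, |p x - q x|

/-- The mixing time of the chain with transition matrix `P` and stationary distribution `π`:
the least `t` such that, from every starting state, the law after `t` steps is within total
variation distance `1 / (2e)` of `π`. It is `⊤` if there is no such `t`. -/
def mixingTime (P : Matrix S S ℝ) (π : S → ℝ) : ℕ∞ :=
  ⨅ (t : ℕ) (_ : ∀ x, tvDist ((P ^ t) x) π ≤ 1 / (2 * Real.exp 1)), (t : ℕ∞)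

/-- `P` is the transition matrix of a Markov chain that is reversible with respect to `π`
(detailed balance). -/
def IsReversibleChain (P : Matrix S S ℝ) (π : S → ℝ) : Prop :=
  P ∈ Matrix.rowStochastic ℝ S ∧ ∀ x y, π x * P x y = π y * P y x

end Chains

/-! ### The hard-core model on a finite graph -/

section Model

variable {V : Type*} [Fintype V] [DecidableEq V]

/-- The independent sets of a finite graph. -/
def IndepSets (G : SimpleGraph V) : Type _ := {I : Finset V // G.IsIndepSet (I : Set V)}

instance (G : SimpleGraph V) : Fintype (IndepSets G) :=
  letI : Finite (IndepSets G) :=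
    inferInstanceAs (Finite {I : Finset V // G.IsIndepSet (I : Set V)})
  Fintype.ofFinite _

instance (G : SimpleGraph V) : DecidableEq (IndepSets G) :=
  inferInstanceAs (DecidableEq {I : Finset V // G.IsIndepSet (I : Set V)})

/-- The hard-core distribution with activity `lam`. -/
def hardCore (G : SimpleGraph V) (lam : ℝ) (I : IndepSets G) : ℝ :=
  lam ^ I.1.card / ∑ J : IndepSets G, lam ^ J.1.card

open Classical in
/-- Transition matrix of the Glauber dynamics: a vertex `v` is chosen uniformly at random; if all
its neighbours are unoccupied, then `v` becomes occupied with probability `lam / (lam + 1)` and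
unoccupied with the remaining probability; if some neighbour is occupied, then `v` is set to be
unoccupied. -/
def glauber (G : SimpleGraph V) (lam : ℝ) : Matrix (IndepSets G) (IndepSets G) ℝ :=
  fun I J => (1 / (Fintype.card V : ℝ)) * ∑ v : V,
    if ∀ w, G.Adj v w → w ∉ I.1 then
      lam / (lam + 1) * (if J.1 = insert v I.1 then 1 else 0)
        + (1 - lam / (lam + 1)) * (if J.1 = I.1.erase v then 1 else 0)
    else (if J.1 = I.1.erase v then 1 else 0)

/-- Every step of the chain changes the state (occupied or not) of at most `k` vertices. -/
def UpdatesAtMost {G : SimpleGraph V} (k : ℕ) (P : Matrix (IndepSets G) (IndepSets G) ℝ) : Prop :=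
  ∀ I J, P I J ≠ 0 → (symmDiff I.1 J.1).card ≤ k

end Model

/-! ### The random graph -/

/-- The bipartite graph with sides `V₁ = V₂ = Fin n` that is the union of the `d` perfect
matchings `i ↦ σ k i`; parallel edges are merged, which does not affect the hard-core model. -/
def matchingGraph {n d : ℕ} (σ : Fin d → Equiv.Perm (Fin n)) : SimpleGraph (Fin n ⊕ Fin n) :=
  SimpleGraph.fromRel fun u v => ∃ i k, u = Sum.inl i ∧ v = Sum.inr (σ k i)

/-- Probability of an event when `d` perfect matchings between two `n`-sets are chosen
independently and uniformly at random. -/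
def matchingProb (n d : ℕ) (E : Set (Fin d → Equiv.Perm (Fin n))) : ℝ :=
  (E.ncard : ℝ) / (Fintype.card (Fin d → Equiv.Perm (Fin n)) : ℝ)

/-- The critical activity of the `d`-regular tree. -/
def lamCrit (d : ℕ) : ℝ := ((d : ℝ) - 1) ^ (d - 1) / ((d : ℝ) - 2) ^ d

end HardCore

end

/-! Let `rate` be the exponential rate of the expected weight of independent sets with densities α
(left) and β (right). Above λ_c its maximum is not attained on the diagonal (`exists_rate_gap`): an
interior diagonal maximizer would satisfy λ = α(1-α)^(d-1)/(1-2α)^d, which forces αd > 1, and then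
the second derivative across the diagonal is positive. By symmetry there is a left-heavy and a
right-heavy maximizer, while nearly balanced sets are exponentially lighter in expectation. Markov's
inequality turns expectations into upper bounds on typical graphs (`typicalMatchings`,
`sum_indepPairs_le`).

The lower bound for the heavy phases uses no second moment: the partition function is at least exp(n
· rate) for every union of d matchings (`exp_rate_le_pairZ`). To see this, average over random
M-fold lifts. The independent sets with a copies in every left fibre and b in every right fibre have
expected weight (x^a y^b E)^n, where E is the expected number for d matchings of two M-sets. On the
other hand every lift has partition function at most the M-th power of that of the base
(`sum_liftWeight_le`): after the right side is summed out, the weight on left configurations is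
log-supermodular; sorting every fibre splits a configuration into M configurations of the base and
does not decrease the weight; and `sum_le_pow_of_le_prod_level` turns this pointwise domination into
a bound on sums, one vertex at a time, by Gibbs' inequality. Then M tends to infinity.

Applied with activities λe^η and λe^(-η), or the reverse, the lower bound shows that each heavy
phase alone has almost the maximal weight (`exp_le_sum_indepPairs_imbalanced`). The nearly balanced
sets are thus an exponentially small bottleneck that no chain with few updates per step can jump
over (`IsReversibleChain.le_mul_of_tvDist_le`). -/

namespace HardCore

/-! ### Log-supermodular weights on the subsets of one fibre -/

/-- Summation by parts: a nonnegative antitone sequence integrates nonnegative partial sums. -/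
lemma mul_sum_le_sum_mul_of_partial_sums_nonneg (P δ : ℕ → ℝ) (k : ℕ)
    (hP : ∀ i < k, P (i + 1) ≤ P i)
    (hδ : ∀ j < k, 0 ≤ ∑ i ∈ Finset.range (j + 1), δ i) :
    P k * ∑ i ∈ Finset.range (k + 1), δ i ≤ ∑ i ∈ Finset.range (k + 1), P i * δ i := by
  induction k with
  | zero => simp
  | succ k ih =>
    have h := ih (fun i hi => hP i (by omega)) (fun j hj => hδ j (by omega))
    rw [Finset.sum_range_succ, Finset.sum_range_succ (fun i => P i * δ i)]
    have h1 := mul_le_mul_of_nonneg_right (hP k (by omega)) (hδ k (by omega))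
    linarith

/-- The first `k` elements of `Fin M`. -/
def initialFin (M k : ℕ) : Finset (Fin M) := Finset.univ.filter fun j => j.val < k

lemma card_initialFin {M k : ℕ} (hk : k ≤ M) : (initialFin M k).card = k := by
  rw [initialFin, Fin.card_filter_val_lt, min_eq_right hk]

/-- A function on a lattice with `F x * F y ≤ F (x ⊓ y) * F (x ⊔ y)`. -/
def LogSupermodular {L : Type*} [Lattice L] (F : L → ℝ) : Prop :=
  ∀ x y, F x * F y ≤ F (x ⊓ y) * F (x ⊔ y)

/-- Log-supermodularity gives increasing returns: adding a new largest element `m` to `A` gains at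
most the factor gained by adding it to the whole segment below `m`. Induct on the largest element.
-/
lemma LogSupermodular.le_prod_initialFin {M : ℕ} {F : Finset (Fin M) → ℝ} (hF : ∀ A, 0 < F A)
    (hsm : LogSupermodular F) (A : Finset (Fin M)) :
    F A ≤ F ∅ * ∏ i ∈ A, (F (initialFin M (i.val + 1)) / F (initialFin M i.val)) := by
  induction A using Finset.induction_on_max with
  | empty => simp
  | insert m A hlt ih =>
    have hm : m ∉ A := fun h => lt_irrefl _ (hlt m h)
    rw [Finset.prod_insert hm]
    have h1 := hsm (insert m A) (initialFin M m.val)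
    have h2 : insert m A ⊓ initialFin M m.val = A := by
      ext j
      simp only [Finset.inf_eq_inter, Finset.mem_inter, Finset.mem_insert, initialFin,
        Finset.mem_filter, Finset.mem_univ, true_and]
      constructor
      · rintro ⟨rfl | h, h'⟩
        · exact absurd h' (lt_irrefl _)
        · exact h
      · exact fun h => ⟨Or.inr h, hlt j h⟩
    have h3 : insert m A ⊔ initialFin M m.val = initialFin M (m.val + 1) := by
      ext j
      simp only [Finset.sup_eq_union, Finset.mem_union, Finset.mem_insert, initialFin,
        Finset.mem_filter, Finset.mem_univ, true_and]
      constructor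
      · rintro ((rfl | h) | h)
        · omega
        · have := hlt j h
          rw [Fin.lt_def] at this
          omega
        · omega
      · intro h
        by_cases hj : j.val < m.val
        · exact Or.inr hj
        · exact Or.inl (Or.inl (Fin.ext (by omega)))
    rw [h2, h3] at h1
    have h4 : F (insert m A) ≤
        F (initialFin M (m.val + 1)) / F (initialFin M m.val) * F A := by
      rw [div_mul_eq_mul_div, le_div_iff₀ (hF _)]
      linarith
    calc _ ≤ _ := h4
      _ ≤ F (initialFin M (m.val + 1)) / F (initialFin M m.val) *
          (F ∅ * ∏ i ∈ A, (F (initialFin M (i.val + 1)) / F (initialFin M i.val))) :=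
        mul_le_mul_of_nonneg_left ih (div_pos (hF _) (hF _)).le
      _ = _ := by ring

lemma sum_sum_mem_mul {M : ℕ} (F : Finset (Fin M) → ℝ) (y : Fin M → ℝ) :
    ∑ A, F A * ∑ i ∈ A, y i = ∑ i, (∑ A with i ∈ A, F A) * y i := by
  simp_rw [Finset.mul_sum, Finset.sum_mul, Finset.sum_filter]
  rw [Finset.sum_comm]
  refine Finset.sum_congr rfl fun A _ => ?_
  rw [← Finset.sum_filter]
  simp

/-- Gibbs' inequality: with R(A) = ∏_{i ∈ A} r i, the bound log t ≤ t - 1 reduces the claim to ∑ F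
log(C R / F) ≥ 0. `LogSupermodular.le_prod_initialFin` bounds log F by an additive function with
increments `y`, so this sum is at least ∑ P i δ i. The partial sums of `δ` are nonnegative by the
domination at initial segments, and summation by parts applies because the marginals decrease. -/
lemma sum_prod_range_le_of_antitone_marginals {M : ℕ} (F : Finset (Fin M) → ℝ)
    (hF : ∀ A, 0 < F A) (hsm : LogSupermodular F) (r : ℕ → ℝ) (hr : ∀ i, 0 < r i) (C : ℝ)
    (hC : 0 < C) (hb : ∀ A, F A ≤ C * ∏ i ∈ Finset.range A.card, r i)
    (hmarg : Antitone fun i : Fin M => ∑ A with i ∈ A, F A) :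
    ∑ A, F A ≤ C * ∏ i ∈ Finset.range M, (1 + r i) := by
  set y : ℕ → ℝ := fun i => Real.log (F (initialFin M (i + 1)) / F (initialFin M i)) with hy
  -- Indices are shifted by one: index 0 carries the total mass and the term of the empty set, index
  -- i + 1 the element i.
  set P : ℕ → ℝ := fun i => i.casesOn (∑ A, F A)
    fun j => ∑ A with (∃ a ∈ A, a.val = j), F A with hPdef
  set δ : ℕ → ℝ := fun i => i.casesOn (Real.log C - Real.log (F ∅))
    fun j => Real.log (r j) - y j with hδdef
  have hP0 : P 0 = ∑ A, F A := rfl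
  have hδ0 : δ 0 = Real.log C - Real.log (F ∅) := rfl
  have hδs : ∀ i, δ (i + 1) = Real.log (r i) - y i := fun _ => rfl
  have hPfin : ∀ i : Fin M, P (i.val + 1) = ∑ A with i ∈ A, F A := by
    intro i
    simp only [hPdef]
    refine Finset.sum_congr (Finset.filter_congr fun A _ => ?_) fun _ _ => rfl
    constructor
    · rintro ⟨a, ha, hai⟩
      rwa [← Fin.ext hai]
    · exact fun h => ⟨i, h, rfl⟩
  have hysum : ∀ k, ∑ i ∈ Finset.range k, y i =
      Real.log (F (initialFin M k)) - Real.log (F ∅) := by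
    intro k
    induction k with
    | zero => simp [initialFin]
    | succ k ih =>
      rw [Finset.sum_range_succ, ih, hy]
      simp only
      rw [Real.log_div (hF _).ne' (hF _).ne']
      ring
  have hδsum : ∀ k ≤ M, 0 ≤ ∑ i ∈ Finset.range (k + 1), δ i := by
    intro k hk
    rw [Finset.sum_range_succ']
    simp only [hδ0, hδs, Finset.sum_sub_distrib, hysum]
    have h := hb (initialFin M k)
    rw [card_initialFin hk] at h
    have h' := Real.log_le_log (hF _) h
    rw [Real.log_mul hC.ne' (Finset.prod_pos fun i _ => hr i).ne',
      Real.log_prod (fun i _ => (hr i).ne')] at h'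
    linarith
  have hPanti : ∀ i < M, P (i + 1) ≤ P i := by
    intro i hi
    rcases i with _ | i
    · exact Finset.sum_le_sum_of_subset_of_nonneg (Finset.subset_univ _)
        fun A _ _ => (hF A).le
    · rw [hPfin ⟨i + 1, hi⟩, hPfin ⟨i, by omega⟩]
      exact hmarg (by simp [Fin.le_def])
  have habel := mul_sum_le_sum_mul_of_partial_sums_nonneg P δ M hPanti
    fun j hj => hδsum j hj.le
  have hPM : 0 ≤ P M := by
    rcases M with _ | M
    · exact Finset.sum_nonneg fun A _ => (hF A).le
    · rw [hPfin ⟨M, by omega⟩]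
      exact Finset.sum_nonneg fun A _ => (hF A).le
  have hnonneg : 0 ≤ ∑ i ∈ Finset.range (M + 1), P i * δ i :=
    (mul_nonneg hPM (hδsum M le_rfl)).trans habel
  set R : Finset (Fin M) → ℝ := fun A => ∏ i ∈ A, r i.val with hR
  have hRpos : ∀ A, 0 < R A := fun A => Finset.prod_pos fun i _ => hr _
  have hkey : 0 ≤ ∑ A, F A * Real.log (C * R A / F A) := by
    have h1 : ∀ A, F A * (Real.log C - Real.log (F ∅)
        + ∑ i ∈ A, (Real.log (r i.val) - y i.val)) ≤ F A * Real.log (C * R A / F A) := by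
      intro A
      refine mul_le_mul_of_nonneg_left ?_ (hF A).le
      have h := Real.log_le_log (hF A) (hsm.le_prod_initialFin hF A)
      have hq : ∀ i ∈ A, F (initialFin M (i.val + 1)) / F (initialFin M i.val) ≠ 0 :=
        fun i _ => (div_pos (hF _) (hF _)).ne'
      rw [Real.log_mul (hF _).ne' (Finset.prod_ne_zero_iff.2 hq), Real.log_prod hq] at h
      rw [Real.log_div (mul_pos hC (hRpos A)).ne' (hF A).ne',
        Real.log_mul hC.ne' (hRpos A).ne', hR]
      simp only
      rw [Real.log_prod (fun i _ => (hr _).ne'), Finset.sum_sub_distrib]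
      linarith
    refine le_trans ?_ (Finset.sum_le_sum fun A _ => h1 A)
    simp_rw [mul_add]
    rw [Finset.sum_add_distrib, sum_sum_mem_mul F (fun i => Real.log (r i.val) - y i.val),
      ← Finset.sum_mul]
    rw [Finset.sum_range_succ', ← Fin.sum_univ_eq_sum_range (fun i => P (i + 1) * δ (i + 1))]
      at hnonneg
    simp_rw [hPfin, hP0, hδ0, hδs] at hnonneg
    linarith
  have hlog : ∑ A, F A * Real.log (C * R A / F A) ≤ ∑ A, (C * R A - F A) := by
    refine Finset.sum_le_sum fun A _ => ?_
    have h := mul_le_mul_of_nonneg_left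
      (Real.log_le_sub_one_of_pos (div_pos (mul_pos hC (hRpos A)) (hF A))) (hF A).le
    rwa [mul_sub, mul_div_cancel₀ _ (hF A).ne', mul_one] at h
  have hfin : ∏ i ∈ Finset.range M, (1 + r i) = ∑ A, R A := by
    rw [← Fin.prod_univ_eq_prod_range (fun i => 1 + r i), Finset.prod_one_add,
      Finset.powerset_univ]
  rw [hfin, Finset.mul_sum]
  rw [Finset.sum_sub_distrib] at hlog
  linarith

/-- A positive log-supermodular function on the subsets of an `M`-set that is dominated by the
products of the first terms of a sequence has total mass at most that of the product
weight. -/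
lemma LogSupermodular.sum_le_prod_one_add {M : ℕ} {F : Finset (Fin M) → ℝ} (hF : ∀ A, 0 < F A)
    (hsm : LogSupermodular F) (r : ℕ → ℝ) (hr : ∀ i, 0 < r i) (C : ℝ) (hC : 0 < C)
    (hb : ∀ A, F A ≤ C * ∏ i ∈ Finset.range A.card, r i) :
    ∑ A, F A ≤ C * ∏ i ∈ Finset.range M, (1 + r i) := by
  set p : Fin M → ℝ := fun i => ∑ A with i ∈ A, F A with hp
  -- Elements may be relabelled so that the marginals decrease, since the domination hypothesis sees
  -- only the size of `A`.
  set τ : Equiv.Perm (Fin M) := Tuple.sort fun i => -p i with hτ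
  set F' : Finset (Fin M) → ℝ := fun A => F (A.map τ.toEmbedding) with hF'
  have hsum : ∑ A, F' A = ∑ A, F A :=
    Fintype.sum_equiv τ.finsetCongr _ _ fun A => by simp [hF']
  rw [← hsum]
  refine sum_prod_range_le_of_antitone_marginals F' (fun A => hF _) ?_ r hr C hC ?_ ?_
  · intro A B
    have h := hsm (A.map τ.toEmbedding) (B.map τ.toEmbedding)
    simpa only [hF', Finset.inf_eq_inter, Finset.sup_eq_union, Finset.map_inter,
      Finset.map_union] using h
  · intro A
    simpa [hF'] using hb (A.map τ.toEmbedding)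
  · have h1 : (fun i : Fin M => ∑ A with i ∈ A, F' A) = fun i => p (τ i) := by
      funext i
      simp only [hp, hF', Finset.sum_filter]
      exact Fintype.sum_equiv τ.finsetCongr _ _ fun A => by simp
    rw [h1]
    intro i j hij
    have := Tuple.monotone_sort (fun i => -p i) hij
    simp only [Function.comp] at this
    linarith

/-! ### Log-supermodular weights on many fibres -/

lemma LogSupermodular.mul {L : Type*} [Lattice L] {F G : L → ℝ} (hF : LogSupermodular F)
    (hG : LogSupermodular G) (hF0 : ∀ x, 0 ≤ F x) (hG0 : ∀ x, 0 ≤ G x) :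
    LogSupermodular fun x => F x * G x := by
  intro x y
  calc F x * G x * (F y * G y) = (F x * F y) * (G x * G y) := by ring
    _ ≤ (F (x ⊓ y) * F (x ⊔ y)) * (G (x ⊓ y) * G (x ⊔ y)) :=
      mul_le_mul (hF x y) (hG x y) (mul_nonneg (hG0 _) (hG0 _)) (mul_nonneg (hF0 _) (hF0 _))
    _ = _ := by ring

lemma LogSupermodular.prod {L ι : Type*} [Lattice L] (s : Finset ι) {F : ι → L → ℝ}
    (hF : ∀ i ∈ s, LogSupermodular (F i)) (hF0 : ∀ i ∈ s, ∀ x, 0 ≤ F i x) :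
    LogSupermodular fun x => ∏ i ∈ s, F i x := by
  intro x y
  simp only [← Finset.prod_mul_distrib]
  exact Finset.prod_le_prod (fun i hi => mul_nonneg (hF0 i hi _) (hF0 i hi _))
    fun i hi => hF i hi x y

/-- If `φ` holds at both points it holds at meet and join; if at only one, it survives at the meet.
-/
lemma logSupermodular_ite {L : Type*} [Lattice L] (φ : L → Prop) [DecidablePred φ] {c : ℝ} (hc : 1 ≤ c)
    (hsup : ∀ x y, φ x → φ y → φ (x ⊔ y)) (hmono : ∀ x y, y ≤ x → φ x → φ y) :
    LogSupermodular fun x => if φ x then c else 1 := by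
  intro x y
  have hge : ∀ z, (1 : ℝ) ≤ if φ z then c else 1 := fun z => by split_ifs <;> linarith
  by_cases hx : φ x
  · have h1 := hmono x (x ⊓ y) inf_le_left hx
    by_cases hy : φ y
    · simp [hx, hy, h1, hsup x y hx hy]
    · simp only [hx, hy, h1, if_true, if_false]
      exact mul_le_mul_of_nonneg_left (hge _) (by linarith)
  · by_cases hy : φ y
    · have h1 := hmono y (x ⊓ y) inf_le_right hy
      simp only [hx, hy, h1, if_true, if_false, one_mul]
      exact le_mul_of_one_le_right (by linarith) (hge _)
    · simp only [hx, hy, if_false]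
      exact mul_le_mul (hge _) (hge _) zero_le_one (zero_le_one.trans (hge _))

lemma cons_inf {m : ℕ} {α : Type*} [Lattice α] (a b : α) (x y : Fin m → α) :
    (Fin.cons a x : Fin (m + 1) → α) ⊓ Fin.cons b y = Fin.cons (a ⊓ b) (x ⊓ y) := by
  funext i
  refine Fin.cases ?_ (fun i => ?_) i <;> simp

lemma cons_sup {m : ℕ} {α : Type*} [Lattice α] (a b : α) (x y : Fin m → α) :
    (Fin.cons a x : Fin (m + 1) → α) ⊔ Fin.cons b y = Fin.cons (a ⊔ b) (x ⊔ y) := by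
  funext i
  refine Fin.cases ?_ (fun i => ?_) i <;> simp

/-- Marginals of nonnegative log-supermodular functions are log-supermodular. -/
lemma LogSupermodular.sum_cons {m : ℕ} {α : Type*} [DistribLattice α] [Fintype α]
    {F : (Fin (m + 1) → α) → ℝ} (hF : LogSupermodular F) (hF0 : ∀ x, 0 ≤ F x) :
    LogSupermodular fun x : Fin m → α => ∑ a, F (Fin.cons a x) := by
  intro x y
  refine four_functions_theorem_univ _ _ _ _ (fun _ => hF0 _) (fun _ => hF0 _) (fun _ => hF0 _)
    (fun _ => hF0 _) fun a b => ?_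
  have h := hF (Fin.cons a x) (Fin.cons b y)
  rwa [cons_inf, cons_sup] at h

lemma sum_cons {m : ℕ} {α : Type*} [Fintype α] (F : (Fin (m + 1) → α) → ℝ) :
    ∑ x, F x = ∑ x : Fin m → α, ∑ a, F (Fin.cons a x) := by
  rw [← Fintype.sum_equiv (Fin.consEquiv fun _ => α) (fun p => F (Fin.cons p.1 p.2)) F
    fun p => rfl, Fintype.sum_prod_type, Finset.sum_comm]

/-- The coordinates whose set has more than `i` elements. -/
def level {m M : ℕ} (x : Fin m → Finset (Fin M)) (i : ℕ) : Fin m → Bool :=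
  fun v => decide (i < (x v).card)

lemma level_cons {m M : ℕ} (A : Finset (Fin M)) (x : Fin m → Finset (Fin M)) (i : ℕ) :
    level (Fin.cons A x) i = Fin.cons (decide (i < A.card)) (level x i) := by
  funext v
  refine Fin.cases ?_ (fun v => ?_) v <;> simp [level]

/-- If a log-supermodular weight on `M` copies is dominated by the product of the weights of the
levels of the sorted configuration, then its total mass is at most the `M`-th power. -/
theorem sum_le_pow_of_le_prod_level {M : ℕ} (m : ℕ) (F : (Fin m → Finset (Fin M)) → ℝ)
    (g : (Fin m → Bool) → ℝ) (hF0 : ∀ x, 0 < F x) (hg0 : ∀ z, 0 < g z)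
    (hF : LogSupermodular F)
    (hFg : ∀ x, F x ≤ ∏ i ∈ Finset.range M, g (level x i)) :
    ∑ x, F x ≤ (∑ z, g z) ^ M := by
  induction m with
  | zero =>
    rw [Fintype.sum_unique, Fintype.sum_unique]
    refine (hFg _).trans_eq ?_
    rw [Finset.prod_congr rfl fun i _ => congrArg g (Subsingleton.elim (level _ i) default),
      Finset.prod_const, Finset.card_range]
    exact congrArg (g · ^ M) (Subsingleton.elim _ _)
  | succ m ih =>
    rw [sum_cons F, sum_cons g]
    -- The first vertex is summed out of both weights. What remains is the level domination for the
    -- marginals, a one-fibre statement for each fixed `x`.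
    refine ih _ _ (fun x => Finset.sum_pos (fun _ _ => hF0 _) Finset.univ_nonempty)
      (fun z => Finset.sum_pos (fun _ _ => hg0 _) Finset.univ_nonempty)
      (hF.sum_cons fun x => (hF0 x).le) fun x => ?_
    -- The cost of occupying the first vertex at level i. With this choice C ∏ (1 + r i) is the
    -- product over the levels of the marginal of `g`.
    set r : ℕ → ℝ := fun i => g (Fin.cons true (level x i)) / g (Fin.cons false (level x i))
      with hr
    have hrpos : ∀ i, 0 < r i := fun i => div_pos (hg0 _) (hg0 _)
    set C : ℝ := ∏ i ∈ Finset.range M, g (Fin.cons false (level x i)) with hC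
    have hCpos : 0 < C := Finset.prod_pos fun i _ => hg0 _
    have hsm : LogSupermodular fun A => F (Fin.cons A x) := by
      intro A B
      have h := hF (Fin.cons A x) (Fin.cons B x)
      rwa [cons_inf, cons_sup, inf_idem, sup_idem] at h
    have hb : ∀ A, F (Fin.cons A x) ≤ C * ∏ i ∈ Finset.range A.card, r i := by
      intro A
      refine (hFg _).trans_eq ?_
      have hA : A.card ≤ M := by simpa using A.card_le_univ
      have h1 : Finset.range A.card = (Finset.range M).filter fun i => i < A.card := by
        ext i
        simp only [Finset.mem_range, Finset.mem_filter]
        omega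
      rw [h1, Finset.prod_filter, hC, ← Finset.prod_mul_distrib]
      refine Finset.prod_congr rfl fun i _ => ?_
      rw [level_cons]
      by_cases hi : i < A.card
      · simp only [hi, decide_true, if_true, hr]
        rw [mul_div_cancel₀ _ (hg0 _).ne']
      · simp [hi]
    refine (hsm.sum_le_prod_one_add (fun A => hF0 _) r hrpos C hCpos hb).trans_eq ?_
    rw [hC, ← Finset.prod_mul_distrib]
    refine Finset.prod_congr rfl fun i _ => ?_
    rw [Fintype.sum_bool, hr]
    simp only
    rw [mul_add, mul_div_cancel₀ _ (hg0 _).ne']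
    ring

/-! ### First moments and typical matchings -/

/-- The permutations that map `A` into the complement of `B`. -/
def avoidingPerms {n : ℕ} (A B : Finset (Fin n)) : Finset (Equiv.Perm (Fin n)) :=
  Finset.univ.filter fun τ => ∀ j ∈ A, τ j ∉ B

lemma exists_perm_mem_iff {n : ℕ} {A A' : Finset (Fin n)} (h : A.card = A'.card) :
    ∃ ρ : Equiv.Perm (Fin n), ∀ j, ρ j ∈ A' ↔ j ∈ A := by
  set e : {x // x ∈ A} ≃ {x // x ∈ A'} := Finset.equivOfCardEq h
  refine ⟨e.extendSubtype, fun j => ⟨fun hj => ?_, fun hj => e.extendSubtype_mem j hj⟩⟩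
  by_contra hj'
  exact e.extendSubtype_not_mem j hj' hj

lemma card_avoidingPerms_congr {n : ℕ} {A A' : Finset (Fin n)} (B : Finset (Fin n))
    (h : A.card = A'.card) : (avoidingPerms A B).card = (avoidingPerms A' B).card := by
  obtain ⟨ρ, hρ⟩ := exists_perm_mem_iff h
  refine Finset.card_bij' (fun τ _ => ρ.symm.trans τ) (fun τ _ => ρ.trans τ) ?_ ?_ ?_ ?_
  · intro τ hτ
    simp only [avoidingPerms, Finset.mem_filter, Finset.mem_univ, true_and] at hτ ⊢
    intro j hj
    exact hτ _ ((hρ _).1 (by simpa using hj))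
  · intro τ hτ
    simp only [avoidingPerms, Finset.mem_filter, Finset.mem_univ, true_and] at hτ ⊢
    intro j hj
    exact hτ _ ((hρ _).2 hj)
  · intro τ _
    ext j
    simp
  · intro τ _
    ext j
    simp

/-- Double counting of pairs (A', τ) with A' of the size of `A` and τ(A') disjoint from `B`: the
number of τ does not depend on A', and each τ admits exactly the subsets of the preimage of the
complement of `B`. -/
lemma card_avoidingPerms_mul_choose {n : ℕ} (A B : Finset (Fin n)) :
    (avoidingPerms A B).card * n.choose A.card =
      n.factorial * (n - B.card).choose A.card := by
  have h1 : ∑ A' ∈ Finset.powersetCard A.card (Finset.univ : Finset (Fin n)),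
      (avoidingPerms A' B).card = n.choose A.card * (avoidingPerms A B).card := by
    rw [Finset.sum_congr rfl fun A' hA' =>
      card_avoidingPerms_congr B (Finset.mem_powersetCard.1 hA').2]
    simp
  have h2 : ∑ A' ∈ Finset.powersetCard A.card (Finset.univ : Finset (Fin n)),
      (avoidingPerms A' B).card = n.factorial * (n - B.card).choose A.card := by
    simp only [avoidingPerms, Finset.card_filter]
    rw [Finset.sum_comm]
    have h3 : ∀ τ : Equiv.Perm (Fin n),
        (∑ A' ∈ Finset.powersetCard A.card (Finset.univ : Finset (Fin n)),
          if ∀ j ∈ A', τ j ∉ B then 1 else 0) = (n - B.card).choose A.card := by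
      intro τ
      rw [← Finset.card_filter]
      have h4 : (Finset.powersetCard A.card (Finset.univ : Finset (Fin n))).filter
          (fun A' => ∀ j ∈ A', τ j ∉ B) =
          Finset.powersetCard A.card (Bᶜ.map τ.symm.toEmbedding) := by
        ext A'
        simp only [Finset.mem_filter, Finset.mem_powersetCard, Finset.subset_univ, true_and]
        rw [and_comm]
        refine and_congr_left fun _ => ?_
        simp [Finset.subset_iff, Finset.mem_map_equiv]
      rw [h4, Finset.card_powersetCard, Finset.card_map, Finset.card_compl, Fintype.card_fin]
    rw [Finset.sum_congr rfl fun τ _ => h3 τ]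
    simp [Fintype.card_perm]
  rw [mul_comm, ← h1, h2]

/-- The probability that a uniformly random permutation of an `n`-set maps a given `a`-set into
the complement of a given `b`-set. -/
noncomputable def avoidProb (n a b : ℕ) : ℝ := ((n - b).choose a : ℝ) / (n.choose a : ℝ)

lemma avoidProb_nonneg (n a b : ℕ) : 0 ≤ avoidProb n a b := by
  unfold avoidProb
  positivity

lemma card_avoidingPerms {n : ℕ} (A B : Finset (Fin n)) :
    ((avoidingPerms A B).card : ℝ) = n.factorial * avoidProb n A.card B.card := by
  have h : (0 : ℝ) < n.choose A.card := by
    exact_mod_cast Nat.choose_pos (by simpa using A.card_le_univ)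
  rw [avoidProb, ← mul_div_assoc, eq_div_iff h.ne']
  exact_mod_cast card_avoidingPerms_mul_choose A B

/-- The expected number of independent sets with `a` vertices on the left and `b` on the right in
the union of `d` random perfect matchings of two `n`-sets. -/
noncomputable def expectedPairs (d n a b : ℕ) : ℝ :=
  (n.choose a : ℝ) * (n.choose b : ℝ) * avoidProb n a b ^ d

/-- The independent sets of the union of the matchings, as pairs of a left and a right part. -/
def indepPairs {n d : ℕ} (σ : Fin d → Equiv.Perm (Fin n)) :
    Finset (Finset (Fin n) × Finset (Fin n)) :=
  Finset.univ.filter fun p => ∀ k, ∀ i ∈ p.1, σ k i ∉ p.2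

/-- The partition function with activities `x` on the left and `y` on the right. -/
noncomputable def pairZ {n d : ℕ} (σ : Fin d → Equiv.Perm (Fin n)) (x y : ℝ) : ℝ :=
  ∑ p ∈ indepPairs σ, x ^ p.1.card * y ^ p.2.card

/-- Number of independent sets with `a` vertices on the left and `b` on the right. -/
def numPairs {n d : ℕ} (σ : Fin d → Equiv.Perm (Fin n)) (a b : ℕ) : ℕ :=
  ((indepPairs σ).filter fun p => p.1.card = a ∧ p.2.card = b).card

lemma card_pi_avoiding {n d : ℕ} (A B : Finset (Fin n)) :
    (((Finset.univ : Finset (Fin d → Equiv.Perm (Fin n))).filter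
      fun σ => (A, B) ∈ indepPairs σ).card : ℝ) =
      (n.factorial * avoidProb n A.card B.card) ^ d := by
  have h : (Finset.univ : Finset (Fin d → Equiv.Perm (Fin n))).filter
      (fun σ => (A, B) ∈ indepPairs σ) = Fintype.piFinset fun _ => avoidingPerms A B := by
    ext σ
    simp [indepPairs, avoidingPerms]
  rw [h, Fintype.card_piFinset]
  push_cast
  simp [card_avoidingPerms]

lemma sum_numPairs (n d a b : ℕ) :
    ∑ σ : Fin d → Equiv.Perm (Fin n), (numPairs σ a b : ℝ) =
      (n.factorial : ℝ) ^ d * expectedPairs d n a b := by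
  set T : Finset (Finset (Fin n) × Finset (Fin n)) :=
    Finset.powersetCard a Finset.univ ×ˢ Finset.powersetCard b Finset.univ with hT
  have h1 : ∀ σ : Fin d → Equiv.Perm (Fin n), (numPairs σ a b : ℝ) =
      ∑ p ∈ T, if p ∈ indepPairs σ then (1 : ℝ) else 0 := by
    intro σ
    rw [← Finset.sum_filter, Finset.sum_const, nsmul_eq_mul, mul_one, numPairs]
    congr 2
    ext p
    simp [hT, and_comm]
  rw [Finset.sum_congr rfl fun σ _ => h1 σ, Finset.sum_comm]
  have h2 : ∀ p ∈ T, (∑ σ : Fin d → Equiv.Perm (Fin n),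
      if p ∈ indepPairs σ then (1 : ℝ) else 0) = (n.factorial * avoidProb n a b) ^ d := by
    rintro ⟨A, B⟩ hp
    simp only [hT, Finset.mem_product, Finset.mem_powersetCard, Finset.subset_univ, true_and]
      at hp
    rw [← Finset.sum_filter, Finset.sum_const, nsmul_eq_mul, mul_one, card_pi_avoiding, hp.1,
      hp.2]
  rw [Finset.sum_congr rfl h2, Finset.sum_const, hT, Finset.card_product,
    Finset.card_powersetCard, Finset.card_powersetCard, Finset.card_univ, Fintype.card_fin,
    nsmul_eq_mul, expectedPairs, mul_pow]
  push_cast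
  ring

lemma numPairs_eq_zero_of_expectedPairs_eq_zero {n d a b : ℕ} (h : expectedPairs d n a b = 0)
    (σ : Fin d → Equiv.Perm (Fin n)) : numPairs σ a b = 0 := by
  have h1 := sum_numPairs n d a b
  rw [h, mul_zero, Finset.sum_eq_zero_iff_of_nonneg fun _ _ => Nat.cast_nonneg _] at h1
  exact_mod_cast h1 σ (Finset.mem_univ _)

lemma expectedPairs_nonneg (d n a b : ℕ) : 0 ≤ expectedPairs d n a b :=
  mul_nonneg (by positivity) (pow_nonneg (avoidProb_nonneg _ _ _) _)

/-- The matchings for which no number of independent sets of given sizes exceeds its expectation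
by a factor of more than `(n + 1) ^ 3`. -/
def typicalMatchings (n d : ℕ) : Set (Fin d → Equiv.Perm (Fin n)) :=
  {σ | ∀ a ≤ n, ∀ b ≤ n, (numPairs σ a b : ℝ) ≤ ((n : ℝ) + 1) ^ 3 * expectedPairs d n a b}

/-- Markov's inequality for the sum over all sizes of count divided by expectation, whose mean is at
most (n + 1)^2. -/
lemma matchingProb_typicalMatchings_ge (n d : ℕ) :
    1 - 1 / ((n : ℝ) + 1) ≤ matchingProb n d (typicalMatchings n d) := by
  set N : ℝ := (Fintype.card (Fin d → Equiv.Perm (Fin n)) : ℝ) with hN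
  have hNeq : N = (n.factorial : ℝ) ^ d := by
    rw [hN]
    simp [Fintype.card_pi, Fintype.card_perm]
  have hNpos : 0 < N := by rw [hNeq]; positivity
  set X : (Fin d → Equiv.Perm (Fin n)) → ℝ := fun σ =>
    ∑ a ∈ Finset.range (n + 1), ∑ b ∈ Finset.range (n + 1),
      (numPairs σ a b : ℝ) / expectedPairs d n a b with hX
  have hX0 : ∀ σ, 0 ≤ X σ := fun σ => Finset.sum_nonneg fun a _ => Finset.sum_nonneg fun b _ =>
    div_nonneg (Nat.cast_nonneg _) (expectedPairs_nonneg _ _ _ _)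
  have hXsum : ∑ σ, X σ ≤ N * ((n : ℝ) + 1) ^ 2 := by
    have h1 : ∑ σ, X σ = ∑ a ∈ Finset.range (n + 1), ∑ b ∈ Finset.range (n + 1),
        ∑ σ : Fin d → Equiv.Perm (Fin n), (numPairs σ a b : ℝ) / expectedPairs d n a b := by
      simp only [hX]
      rw [Finset.sum_comm]
      exact Finset.sum_congr rfl fun a _ => Finset.sum_comm
    rw [h1]
    calc _ ≤ ∑ a ∈ Finset.range (n + 1), ∑ b ∈ Finset.range (n + 1), N := by
          refine Finset.sum_le_sum fun a _ => Finset.sum_le_sum fun b _ => ?_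
          rw [← Finset.sum_div, sum_numPairs, ← hNeq, mul_div_assoc]
          -- Only an inequality: sizes of expectation zero contribute 0 / 0 = 0.
          exact mul_le_of_le_one_right hNpos.le (div_self_le_one _)
      _ = _ := by
          simp only [Finset.sum_const, Finset.card_range, nsmul_eq_mul]
          push_cast
          ring
  classical
  set bad : Finset (Fin d → Equiv.Perm (Fin n)) :=
    Finset.univ.filter fun σ => ((n : ℝ) + 1) ^ 3 < X σ with hbad
  have hbadcard : (bad.card : ℝ) * ((n : ℝ) + 1) ^ 3 ≤ N * ((n : ℝ) + 1) ^ 2 := by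
    calc (bad.card : ℝ) * ((n : ℝ) + 1) ^ 3 = ∑ σ ∈ bad, ((n : ℝ) + 1) ^ 3 := by simp
      _ ≤ ∑ σ ∈ bad, X σ := Finset.sum_le_sum fun σ hσ => (Finset.mem_filter.1 hσ).2.le
      _ ≤ ∑ σ, X σ := Finset.sum_le_sum_of_subset_of_nonneg (Finset.subset_univ _)
          fun σ _ _ => hX0 σ
      _ ≤ _ := hXsum
  have hgood : (badᶜ : Finset _) ⊆ (typicalMatchings n d).toFinset := by
    intro σ hσ
    rw [Set.mem_toFinset]
    simp only [hbad, Finset.mem_compl, Finset.mem_filter, Finset.mem_univ, true_and, not_lt]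
      at hσ
    intro a ha b hb
    rcases (expectedPairs_nonneg d n a b).eq_or_lt' with h0 | hpos
    · rw [h0, numPairs_eq_zero_of_expectedPairs_eq_zero h0 σ]
      simp
    · rw [← div_le_iff₀ hpos]
      refine le_trans ?_ hσ
      have hnn : ∀ a b, 0 ≤ (numPairs σ a b : ℝ) / expectedPairs d n a b := fun a b =>
        div_nonneg (Nat.cast_nonneg _) (expectedPairs_nonneg _ _ _ _)
      calc _ ≤ ∑ b ∈ Finset.range (n + 1), (numPairs σ a b : ℝ) / expectedPairs d n a b :=
            Finset.single_le_sum (f := fun b => (numPairs σ a b : ℝ) / expectedPairs d n a b)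
              (fun b _ => hnn a b) (Finset.mem_range.2 (by omega))
        _ ≤ X σ := Finset.single_le_sum
              (f := fun a => ∑ b ∈ Finset.range (n + 1),
                (numPairs σ a b : ℝ) / expectedPairs d n a b)
              (fun a _ => Finset.sum_nonneg fun b _ => hnn a b) (Finset.mem_range.2 (by omega))
  have hcard : N - bad.card ≤ ((typicalMatchings n d).ncard : ℝ) := by
    rw [Set.ncard_eq_toFinset_card']
    have h := Finset.card_le_card hgood
    rw [Finset.card_compl] at h
    have h' : Fintype.card (Fin d → Equiv.Perm (Fin n)) ≤
      (typicalMatchings n d).toFinset.card + bad.card := by omega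
    have h'' : N ≤ ((typicalMatchings n d).toFinset.card : ℝ) + bad.card := by
      rw [hN]
      exact_mod_cast h'
    linarith
  have hn : (0 : ℝ) < (n : ℝ) + 1 := by positivity
  have hb' : (bad.card : ℝ) * ((n : ℝ) + 1) ≤ N := by
    have hsq : (0 : ℝ) < ((n : ℝ) + 1) ^ 2 := by positivity
    refine le_of_mul_le_mul_right ?_ hsq
    calc _ = (bad.card : ℝ) * ((n : ℝ) + 1) ^ 3 := by ring
      _ ≤ _ := hbadcard
  rw [matchingProb, ← hN, le_div_iff₀ hNpos]
  refine le_trans ?_ hcard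
  rw [sub_mul, one_mul]
  have : (bad.card : ℝ) ≤ 1 / ((n : ℝ) + 1) * N := by
    rw [div_mul_eq_mul_div, one_mul, le_div_iff₀ hn]
    exact hb'
  linarith

/-! ### Lower bound for the partition function from random lifts -/

section Lift

variable {n d M : ℕ} (σ : Fin d → Equiv.Perm (Fin n)) (π : Fin d → Fin n → Equiv.Perm (Fin M))
  (x y : ℝ)

/-- The right vertices without a neighbour in the left set `{u | z u}` contribute `1 + y`. -/
noncomputable def baseWeight (z : Fin n → Bool) : ℝ :=
  (∏ u, if z u then x else 1) * ∏ v, if ∀ k, z ((σ k).symm v) = false then 1 + y else 1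

/-- In the `M`-fold lift given by `π`, the copies of the right vertex `v` without a neighbour in
the left set `X`. -/
def liftFree (X : Fin n → Finset (Fin M)) (v : Fin n) : Finset (Fin M) :=
  Finset.univ.filter fun i => ∀ k, (π k ((σ k).symm v)).symm i ∉ X ((σ k).symm v)

/-- The total weight of the independent sets with left part `X` in the lift given by `π`. -/
noncomputable def liftWeight (X : Fin n → Finset (Fin M)) : ℝ :=
  (∏ u, x ^ (X u).card) * ∏ v, ∏ i, if i ∈ liftFree σ π X v then 1 + y else 1

lemma prod_ite_one_add {ι : Type*} [Fintype ι] [DecidableEq ι] (s : Finset ι) :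
    (∏ i, if i ∈ s then 1 + y else 1) = ∑ t ∈ s.powerset, y ^ t.card := by
  rw [Finset.prod_ite_mem, Finset.univ_inter, Finset.prod_one_add]
  simp

lemma sum_baseWeight : ∑ z, baseWeight σ x y z = pairZ σ x y := by
  have h1 : ∀ A : Finset (Fin n), baseWeight σ x y (fun u => decide (u ∈ A)) =
      ∑ B, if (A, B) ∈ indepPairs σ then x ^ A.card * y ^ B.card else 0 := by
    intro A
    set S : Finset (Fin n) := Finset.univ.filter fun v => ∀ k, (σ k).symm v ∉ A with hS
    have hB : ∀ B : Finset (Fin n), (A, B) ∈ indepPairs σ ↔ B ∈ S.powerset := by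
      intro B
      simp only [indepPairs, Finset.mem_filter, Finset.mem_univ, true_and, Finset.mem_powerset,
        Finset.subset_iff, hS]
      constructor
      · intro h v hv k hk
        exact h k _ hk (by simpa using hv)
      · intro h k i hi hv
        exact h hv k (by simpa using hi)
    have h2 : (∏ v, if ∀ k, (fun u => decide (u ∈ A)) ((σ k).symm v) = false then 1 + y else 1)
        = ∏ v, if v ∈ S then 1 + y else 1 := by
      refine Finset.prod_congr rfl fun v _ => ?_
      simp [hS]
    rw [baseWeight, h2, prod_ite_one_add]
    simp_rw [hB]
    rw [← Finset.sum_filter, Finset.mul_sum]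
    have h3 : (Finset.univ.filter fun B => B ∈ S.powerset) = S.powerset := by
      ext B
      simp
    rw [h3]
    refine Finset.sum_congr rfl fun B _ => ?_
    congr 1
    simp only [decide_eq_true_eq]
    rw [Finset.prod_ite_mem, Finset.univ_inter, Finset.prod_const]
  have h4 : ∑ z, baseWeight σ x y z =
      ∑ A : Finset (Fin n), baseWeight σ x y (fun u => decide (u ∈ A)) := by
    refine (Finset.sum_nbij' (fun A : Finset (Fin n) => fun u => decide (u ∈ A))
      (fun z => Finset.univ.filter fun u => z u = true) ?_ ?_ ?_ ?_ ?_).symm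
    · simp
    · simp
    · intro A _
      ext u
      simp
    · intro z _
      funext u
      simp
    · simp
  rw [h4, Finset.sum_congr rfl fun A _ => h1 A, pairZ, ← Fintype.sum_prod_type'
    (f := fun A B => if (A, B) ∈ indepPairs σ then x ^ A.card * y ^ B.card else 0)]
  simp only [Prod.mk.eta]
  rw [← Finset.sum_filter]
  refine Finset.sum_congr ?_ fun _ _ => rfl
  ext p
  simp

variable {x y}

lemma baseWeight_pos (hx : 0 < x) (hy : 0 < y) (z : Fin n → Bool) : 0 < baseWeight σ x y z := by
  refine mul_pos (Finset.prod_pos fun u _ => ?_) (Finset.prod_pos fun v _ => ?_)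
  · split_ifs <;> linarith
  · split_ifs <;> linarith

lemma liftWeight_pos (hx : 0 < x) (hy : 0 < y) (X : Fin n → Finset (Fin M)) :
    0 < liftWeight σ π x y X := by
  refine mul_pos (Finset.prod_pos fun u _ => pow_pos hx _)
    (Finset.prod_pos fun v _ => Finset.prod_pos fun i _ => ?_)
  split_ifs <;> linarith

/-- Eliminating the right side makes the model attractive: the left factor is modular, and the
freeness of a right copy is inherited by smaller left sets and by unions. -/
lemma logSupermodular_liftWeight (hx : 0 < x) (hy : 0 < y) :
    LogSupermodular (liftWeight σ π x y) := by
  have hite : ∀ p : Prop, ∀ [Decidable p], (0 : ℝ) ≤ if p then 1 + y else 1 := by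
    intro p _
    split_ifs <;> linarith
  refine LogSupermodular.mul (LogSupermodular.prod _ (fun u _ => ?_)
    fun u _ X => (pow_pos hx _).le) (LogSupermodular.prod _ (fun v _ => LogSupermodular.prod _
      (fun i _ => ?_) fun i _ X => hite _) fun v _ X => Finset.prod_nonneg fun i _ => hite _)
    (fun X => Finset.prod_nonneg fun u _ => (pow_pos hx _).le)
    (fun X => Finset.prod_nonneg fun v _ => Finset.prod_nonneg fun i _ => hite _)
  · intro X Y
    rw [← pow_add, ← pow_add]
    refine le_of_eq (congrArg (x ^ ·) ?_)
    simp [Finset.card_inter_add_card_union]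
  · refine logSupermodular_ite (fun X => i ∈ liftFree σ π X v) (by linarith) ?_ ?_
    · intro X Y hX hY
      simp only [liftFree, Finset.mem_filter, Finset.mem_univ, true_and] at hX hY ⊢
      intro k
      simp [hX k, hY k]
    · intro X Y hYX hX
      simp only [liftFree, Finset.mem_filter, Finset.mem_univ, true_and] at hX ⊢
      exact fun k hk => hX k (hYX _ hk)

/-- Each neighbouring fibre blocks as many copies of `v` as it has occupied elements, so at most M
minus the largest such number are free. Sorting makes the blocked sets nested, and then exactly that
many levels leave `v` free. The left factor does not change. -/
lemma liftWeight_le_prod_level (hd : 0 < d) (hx : 0 < x) (hy : 0 < y)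
    (X : Fin n → Finset (Fin M)) :
    liftWeight σ π x y X ≤ ∏ i ∈ Finset.range M, baseWeight σ x y (level X i) := by
  have hcard : ∀ u, (X u).card ≤ M := fun u => by simpa using (X u).card_le_univ
  simp only [baseWeight, Finset.prod_mul_distrib]
  rw [liftWeight, Finset.prod_comm (s := Finset.range M),
    Finset.prod_comm (s := Finset.range M)]
  refine mul_le_mul (le_of_eq ?_) ?_ ?_ ?_
  · refine Finset.prod_congr rfl fun u _ => ?_
    simp only [level, decide_eq_true_eq]
    rw [Finset.prod_ite, Finset.prod_const, Finset.prod_const_one, mul_one]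
    congr 1
    have : (Finset.range M).filter (fun i => i < (X u).card) = Finset.range (X u).card := by
      ext i
      have := hcard u
      simp only [Finset.mem_filter, Finset.mem_range]
      omega
    rw [this, Finset.card_range]
  · refine Finset.prod_le_prod (fun v _ => Finset.prod_nonneg fun i _ => ?_) fun v _ => ?_
    · split_ifs <;> linarith
    · rw [Finset.prod_ite, Finset.prod_const, Finset.prod_const_one, mul_one,
        Finset.prod_ite, Finset.prod_const, Finset.prod_const_one, mul_one]
      refine pow_le_pow_right₀ (by linarith) ?_
      have : Nonempty (Fin d) := ⟨⟨0, hd⟩⟩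
      obtain ⟨k, hk⟩ := Finite.exists_max fun k => (X ((σ k).symm v)).card
      have h1 : (Finset.univ.filter fun i => i ∈ liftFree σ π X v).card ≤
          M - (X ((σ k).symm v)).card := by
        have hsub : (Finset.univ.filter fun i => i ∈ liftFree σ π X v) ⊆
            ((X ((σ k).symm v)).map (π k ((σ k).symm v)).toEmbedding)ᶜ := by
          intro i hi
          simp only [liftFree, Finset.mem_filter, Finset.mem_univ, true_and] at hi
          simp only [Finset.mem_compl, Finset.mem_map_equiv]
          exact hi k
        refine (Finset.card_le_card hsub).trans_eq ?_
        rw [Finset.card_compl, Finset.card_map, Fintype.card_fin]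
      refine h1.trans ?_
      have hsub : Finset.Ico (X ((σ k).symm v)).card M ⊆ (Finset.range M).filter
          (fun i => ∀ k, level X i ((σ k).symm v) = false) := by
        intro i hi
        rw [Finset.mem_Ico] at hi
        simp only [level, Finset.mem_filter, Finset.mem_range, decide_eq_false_iff_not, not_lt]
        exact ⟨hi.2, fun k' => (hk k').trans hi.1⟩
      simpa using Finset.card_le_card hsub
  · exact Finset.prod_nonneg fun v _ => Finset.prod_nonneg fun i _ => by split_ifs <;> linarith
  · exact Finset.prod_nonneg fun v _ => Finset.prod_nonneg fun i _ => by split_ifs <;> linarith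

lemma sum_liftWeight_le (hd : 0 < d) (hx : 0 < x) (hy : 0 < y) :
    ∑ X, liftWeight σ π x y X ≤ pairZ σ x y ^ M := by
  rw [← sum_baseWeight]
  exact sum_le_pow_of_le_prod_level n _ _ (liftWeight_pos σ π hx hy) (baseWeight_pos σ hx hy)
    (logSupermodular_liftWeight σ π hx hy) (liftWeight_le_prod_level σ π hd hx hy)

/-- `X` and `B` form an independent set of the lift given by `π`. -/
def LiftIndep (X B : Fin n → Finset (Fin M)) : Prop :=
  ∀ k u, ∀ j ∈ X u, π k u j ∉ B (σ k u)

lemma subset_liftFree_iff (X B : Fin n → Finset (Fin M)) :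
    (∀ v, B v ⊆ liftFree σ π X v) ↔ LiftIndep σ π X B := by
  simp only [liftFree, LiftIndep, Finset.subset_iff, Finset.mem_filter, Finset.mem_univ, true_and]
  constructor
  · intro h k u j hj hB
    exact h (σ k u) hB k (by simpa using hj)
  · intro h v i hi k hX
    exact h k _ _ hX (by simpa using hi)

-- From the expansion of the factors 1 + y only the terms with exactly `b` occupied copies in each
-- right fibre are kept.
open Classical in
lemma le_liftWeight (hx : 0 < x) (hy : 0 < y) {a : ℕ} (b : ℕ) {X : Fin n → Finset (Fin M)}
    (hX : ∀ u, (X u).card = a) :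
    (x ^ a * y ^ b) ^ n * ∑ B ∈ Fintype.piFinset fun _ : Fin n =>
      Finset.powersetCard b (Finset.univ : Finset (Fin M)),
        (if LiftIndep σ π X B then (1 : ℝ) else 0) ≤ liftWeight σ π x y X := by
  have h1 : ∑ B ∈ Fintype.piFinset fun _ : Fin n =>
      Finset.powersetCard b (Finset.univ : Finset (Fin M)),
        (if LiftIndep σ π X B then (1 : ℝ) else 0) =
      ∏ v, ((Finset.powersetCard b (liftFree σ π X v)).card : ℝ) := by
    rw [← Finset.sum_filter, Finset.sum_const, nsmul_eq_mul, mul_one, ← Nat.cast_prod,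
      ← Fintype.card_piFinset]
    congr 2
    ext B
    simp only [Finset.mem_filter, Fintype.mem_piFinset, Finset.mem_powersetCard,
      Finset.subset_univ, true_and, ← subset_liftFree_iff, forall_and]
    exact and_comm
  rw [h1, liftWeight, mul_pow]
  have h2 : ∏ u, x ^ (X u).card = (x ^ a) ^ n := by
    rw [Finset.prod_congr rfl fun u _ => by rw [hX u]]
    simp
  rw [h2, mul_assoc]
  refine mul_le_mul_of_nonneg_left ?_ (by positivity)
  calc (y ^ b) ^ n * ∏ v, ((Finset.powersetCard b (liftFree σ π X v)).card : ℝ)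
      = ∏ v, (y ^ b * ((Finset.powersetCard b (liftFree σ π X v)).card : ℝ)) := by
        rw [Finset.prod_mul_distrib]
        simp
    _ ≤ _ := by
        refine Finset.prod_le_prod (fun v _ => by positivity) fun v _ => ?_
        rw [prod_ite_one_add]
        calc y ^ b * ((Finset.powersetCard b (liftFree σ π X v)).card : ℝ)
            = ∑ t ∈ Finset.powersetCard b (liftFree σ π X v), y ^ t.card := by
              rw [Finset.sum_congr rfl fun t ht => by rw [(Finset.mem_powersetCard.1 ht).2],
                Finset.sum_const, nsmul_eq_mul, mul_comm]
          _ ≤ _ := by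
              refine Finset.sum_le_sum_of_subset_of_nonneg (fun t ht => ?_)
                fun t _ _ => by positivity
              rw [Finset.mem_powerset]
              exact (Finset.mem_powersetCard.1 ht).1

-- The permutations on the dn edges are chosen independently, and each has the same avoidance
-- probability because all fibre sizes agree; so `σ` drops out of the count.
open Classical in
lemma sum_liftIndep {a b : ℕ} {X B : Fin n → Finset (Fin M)}
    (hX : ∀ u, (X u).card = a) (hB : ∀ v, (B v).card = b) :
    ∑ π : Fin d → Fin n → Equiv.Perm (Fin M), (if LiftIndep σ π X B then (1 : ℝ) else 0) =
      ((M.factorial : ℝ) ^ (d * n)) * (avoidProb M a b ^ d) ^ n := by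
  have h : (Finset.univ.filter fun π : Fin d → Fin n → Equiv.Perm (Fin M) =>
      LiftIndep σ π X B) =
      Fintype.piFinset fun k => Fintype.piFinset fun u => avoidingPerms (X u) (B (σ k u)) := by
    ext π
    rw [Finset.mem_filter]
    simp [LiftIndep, avoidingPerms]
  rw [← Finset.sum_filter, Finset.sum_const, nsmul_eq_mul, mul_one, h, Fintype.card_piFinset]
  push_cast
  simp only [Fintype.card_piFinset]
  push_cast
  simp only [card_avoidingPerms, hX, hB, Finset.prod_const, Finset.card_univ, Fintype.card_fin]
  rw [mul_pow, mul_pow, ← pow_mul, ← pow_mul, ← pow_mul, mul_comm d n]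

/-- The partition function of any union of `d` perfect matchings is bounded below by the expected
contribution of a random lift. -/
theorem expectedPairs_pow_le_pairZ_pow (hd : 0 < d) (hx : 0 < x) (hy : 0 < y) (M a b : ℕ) :
    (x ^ a * y ^ b * expectedPairs d M a b) ^ n ≤ pairZ σ x y ^ M := by
  classical
  set TA := Fintype.piFinset fun _ : Fin n => Finset.powersetCard a (Finset.univ : Finset (Fin M))
    with hTA
  set TB := Fintype.piFinset fun _ : Fin n => Finset.powersetCard b (Finset.univ : Finset (Fin M))
    with hTB
  set N : ℝ := (M.factorial : ℝ) ^ (d * n) with hN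
  have hNpos : 0 < N := by positivity
  have hcardT : (Fintype.card (Fin d → Fin n → Equiv.Perm (Fin M)) : ℝ) = N := by
    rw [hN]
    simp [Fintype.card_pi, Fintype.card_perm, ← pow_mul, mul_comm]
  have hmemA : ∀ X ∈ TA, ∀ u, (X u).card = a := fun X hX u => by
    simpa using (Fintype.mem_piFinset.1 hX) u
  have hmemB : ∀ B ∈ TB, ∀ v, (B v).card = b := fun B hB v => by
    simpa using (Fintype.mem_piFinset.1 hB) v
  have hA : (TA.card : ℝ) = (M.choose a : ℝ) ^ n := by simp [hTA, Fintype.card_piFinset]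
  have hB : (TB.card : ℝ) = (M.choose b : ℝ) ^ n := by simp [hTB, Fintype.card_piFinset]
  have hupper : ∑ π : Fin d → Fin n → Equiv.Perm (Fin M), ∑ X, liftWeight σ π x y X ≤
      N * pairZ σ x y ^ M := by
    calc _ ≤ ∑ π : Fin d → Fin n → Equiv.Perm (Fin M), pairZ σ x y ^ M :=
          Finset.sum_le_sum fun π _ => sum_liftWeight_le σ π hd hx hy
      _ = _ := by rw [Finset.sum_const, nsmul_eq_mul, Finset.card_univ, hcardT]
  -- Restrict to configurations with the same occupation in every fibre, then exchange the sums so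
  -- that the lifts are counted for each fixed pair (X, B).
  have hlower : N * (x ^ a * y ^ b * expectedPairs d M a b) ^ n ≤
      ∑ π : Fin d → Fin n → Equiv.Perm (Fin M), ∑ X, liftWeight σ π x y X := by
    calc N * (x ^ a * y ^ b * expectedPairs d M a b) ^ n
        = (x ^ a * y ^ b) ^ n * ∑ X ∈ TA, ∑ B ∈ TB, N * (avoidProb M a b ^ d) ^ n := by
          rw [Finset.sum_const, Finset.sum_const, nsmul_eq_mul, nsmul_eq_mul, hA, hB,
            expectedPairs]
          ring
      _ = (x ^ a * y ^ b) ^ n * ∑ X ∈ TA, ∑ B ∈ TB,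
            ∑ π : Fin d → Fin n → Equiv.Perm (Fin M),
              (if LiftIndep σ π X B then (1 : ℝ) else 0) := by
          congr 1
          exact Finset.sum_congr rfl fun X hX => Finset.sum_congr rfl fun B hB =>
            (sum_liftIndep σ (hmemA X hX) (hmemB B hB)).symm
      _ = ∑ π : Fin d → Fin n → Equiv.Perm (Fin M), ∑ X ∈ TA, (x ^ a * y ^ b) ^ n *
            ∑ B ∈ TB, (if LiftIndep σ π X B then (1 : ℝ) else 0) := by
          simp_rw [← Finset.mul_sum]
          congr 1
          rw [Finset.sum_comm (s := Finset.univ)]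
          exact Finset.sum_congr rfl fun X _ => Finset.sum_comm
      _ ≤ ∑ π : Fin d → Fin n → Equiv.Perm (Fin M), ∑ X ∈ TA, liftWeight σ π x y X :=
          Finset.sum_le_sum fun π _ => Finset.sum_le_sum fun X hX =>
            le_liftWeight σ π hx hy b (hmemA X hX)
      _ ≤ _ := Finset.sum_le_sum fun π _ => Finset.sum_le_sum_of_subset_of_nonneg
          (Finset.subset_univ _) fun X _ _ => (liftWeight_pos σ π hx hy X).le
  exact le_of_mul_le_mul_left (hlower.trans hupper) hNpos

end Lift

/-! ### Stirling's formula and the rate function -/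

/-- The difference between `log k!` and its leading term in Stirling's formula. -/
noncomputable def stirlingError (k : ℕ) : ℝ :=
  Real.log k.factorial - (k * Real.log k - k)

lemma stirlingError_succ (k : ℕ) :
    stirlingError (k + 1) = stirlingError k + (1 - k * (Real.log (k + 1) - Real.log k)) := by
  simp only [stirlingError, Nat.factorial_succ]
  push_cast
  rw [Real.log_mul (by positivity) (by positivity)]
  ring

lemma stirlingError_nonneg (k : ℕ) : 0 ≤ stirlingError k := by
  induction k with
  | zero => simp [stirlingError]
  | succ k ih =>
    rw [stirlingError_succ]
    suffices (k : ℝ) * (Real.log (k + 1) - Real.log k) ≤ 1 by linarith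
    rcases k.eq_zero_or_pos with rfl | hk
    · simp
    · have hk' : (0 : ℝ) < k := by exact_mod_cast hk
      rw [← Real.log_div (by positivity) hk'.ne']
      have h := Real.log_le_sub_one_of_pos (show (0 : ℝ) < (k + 1) / k by positivity)
      calc (k : ℝ) * Real.log ((k + 1) / k) ≤ k * ((k + 1) / k - 1) :=
            mul_le_mul_of_nonneg_left h hk'.le
        _ = 1 := by field_simp; ring

lemma stirlingError_le (k : ℕ) : stirlingError k ≤ Real.log (k + 1) + 1 := by
  induction k with
  | zero => simp [stirlingError]
  | succ k ih =>
    rcases k.eq_zero_or_pos with rfl | hk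
    · have : 0 ≤ Real.log ((1 : ℝ) + 1) := Real.log_nonneg (by norm_num)
      simp [stirlingError]
      linarith
    -- The sharper bound, with log(k + 1) in place of log(k + 2), is the one that propagates: its
    -- induction step is (k + 2)(log(k + 2) - log(k + 1)) ≥ 1.
    · suffices h : stirlingError (k + 1) ≤ Real.log ((k : ℝ) + 1) + 1 by
        push_cast
        have : Real.log ((k : ℝ) + 1) ≤ Real.log ((k : ℝ) + 1 + 1) :=
          Real.log_le_log (by positivity) (by linarith)
        linarith
      clear ih
      induction k, hk using Nat.le_induction with
      | base =>
        have h2 : (1 : ℝ) + 1 = 2 := by norm_num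
        have := Real.log_two_gt_d9
        rw [stirlingError_succ]
        simp [stirlingError, h2]
        linarith
      | succ k hk ih =>
        rw [stirlingError_succ]
        push_cast
        have hk' : (0 : ℝ) < (k : ℝ) + 1 := by positivity
        have h := Real.one_sub_inv_le_log_of_pos
          (show (0 : ℝ) < ((k : ℝ) + 1 + 1) / (k + 1) by positivity)
        rw [Real.log_div (by positivity) hk'.ne'] at h
        have h3 : 1 - (((k : ℝ) + 1 + 1) / (k + 1))⁻¹ = 1 / ((k : ℝ) + 2) := by
          field_simp
          ring
        rw [h3] at h
        have h4 := mul_le_mul_of_nonneg_left h (show (0 : ℝ) ≤ (k : ℝ) + 2 by positivity)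
        rw [mul_one_div_cancel (by positivity)] at h4
        linarith

lemma stirlingError_le_of_le {k n : ℕ} (h : k ≤ n) : stirlingError k ≤ Real.log (n + 1) + 1 := by
  refine (stirlingError_le k).trans ?_
  have : Real.log ((k : ℝ) + 1) ≤ Real.log ((n : ℝ) + 1) :=
    Real.log_le_log (by positivity) (by exact_mod_cast Nat.succ_le_succ h)
  linarith

/-- The exponential rate of the expected weight of the independent sets with densities `α` on the
left and `β` on the right, for activities `x` on the left and `y` on the right. -/
noncomputable def rate (d : ℕ) (x y α β : ℝ) : ℝ :=
  α * Real.log x + β * Real.log y + Real.negMulLog α + Real.negMulLog β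
    - ((d : ℝ) - 1) * (Real.negMulLog (1 - α) + Real.negMulLog (1 - β))
    + d * Real.negMulLog (1 - α - β)

lemma continuous_rate (d : ℕ) (x y : ℝ) : Continuous fun p : ℝ × ℝ => rate d x y p.1 p.2 := by
  have h := Real.continuous_negMulLog
  unfold rate
  fun_prop

lemma rate_comm (d : ℕ) (x α β : ℝ) : rate d x x α β = rate d x x β α := by
  have h : 1 - α - β = 1 - β - α := by ring
  rw [rate, rate, h]
  ring

lemma mul_negMulLog_div {n : ℝ} (hn : 0 < n) (k : ℝ) :
    n * Real.negMulLog (k / n) = k * Real.log n - k * Real.log k := by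
  rcases eq_or_ne k 0 with rfl | hk
  · simp
  · rw [Real.negMulLog, Real.log_div hk hn.ne']
    field_simp
    ring

lemma expectedPairs_pos (d : ℕ) {n a b : ℕ} (h : a + b ≤ n) : 0 < expectedPairs d n a b := by
  have h1 : 0 < n.choose a := Nat.choose_pos (by omega)
  have h2 : 0 < n.choose b := Nat.choose_pos (by omega)
  have h3 : 0 < (n - b).choose a := Nat.choose_pos (by omega)
  unfold expectedPairs avoidProb
  positivity

lemma log_choose {n a : ℕ} (h : a ≤ n) : Real.log (n.choose a) =
    Real.log n.factorial - Real.log a.factorial - Real.log (n - a).factorial := by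
  have h1 := Nat.choose_mul_factorial_mul_factorial h
  have h2 : 0 < n.choose a := Nat.choose_pos h
  rw [← h1]
  push_cast
  rw [Real.log_mul (by positivity) (by positivity), Real.log_mul (by positivity) (by positivity)]
  ring

lemma log_expectedPairs (d : ℕ) {n a b : ℕ} (h : a + b ≤ n) :
    Real.log (expectedPairs d n a b) = 2 * Real.log n.factorial - Real.log a.factorial
      - Real.log (n - a).factorial - Real.log b.factorial - Real.log (n - b).factorial
      + d * (Real.log (n - b).factorial + Real.log (n - a).factorial
        - Real.log (n - a - b).factorial - Real.log n.factorial) := by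
  have h1 : 0 < n.choose a := Nat.choose_pos (by omega)
  have h2 : 0 < n.choose b := Nat.choose_pos (by omega)
  have h3 : 0 < (n - b).choose a := Nat.choose_pos (by omega)
  have h4 : n - b - a = n - a - b := by omega
  rw [expectedPairs, avoidProb, Real.log_mul (by positivity) (by positivity),
    Real.log_mul (by positivity) (by positivity), Real.log_pow,
    Real.log_div (by positivity) (by positivity), log_choose (by omega), log_choose (by omega),
    log_choose (show a ≤ n - b by omega), h4]
  ring

/-- The leading Stirling terms assemble exactly into n · rate, so the difference is a combination of
values of `stirlingError`, with total coefficient 6 outside the bracket and 4 inside it. -/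
lemma abs_log_expectedPairs_sub_le (d : ℕ) {n a b : ℕ} (hn : 0 < n) (h : a + b ≤ n) (x y : ℝ) :
    |a * Real.log x + b * Real.log y + Real.log (expectedPairs d n a b)
      - n * rate d x y (a / n) (b / n)| ≤ (6 + 4 * d) * (Real.log (n + 1) + 1) := by
  have hn' : (0 : ℝ) < n := by exact_mod_cast hn
  have hA : (1 : ℝ) - a / n = ((n - a : ℕ) : ℝ) / n := by
    rw [Nat.cast_sub (by omega), sub_div, div_self hn'.ne']
  have hB : (1 : ℝ) - b / n = ((n - b : ℕ) : ℝ) / n := by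
    rw [Nat.cast_sub (by omega), sub_div, div_self hn'.ne']
  have hAB : (1 : ℝ) - a / n - b / n = ((n - a - b : ℕ) : ℝ) / n := by
    rw [Nat.cast_sub (by omega), Nat.cast_sub (by omega), sub_div, sub_div, div_self hn'.ne']
  have hrate : n * rate d x y (a / n) (b / n) = a * Real.log x + b * Real.log y
      + n * Real.negMulLog (a / n) + n * Real.negMulLog (b / n)
      - ((d : ℝ) - 1) * (n * Real.negMulLog (((n - a : ℕ) : ℝ) / n)
        + n * Real.negMulLog (((n - b : ℕ) : ℝ) / n))
      + d * (n * Real.negMulLog (((n - a - b : ℕ) : ℝ) / n)) := by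
    rw [rate, hAB, hA, hB]
    have e1 : (n : ℝ) * (a / n * Real.log x) = a * Real.log x := by field_simp
    have e2 : (n : ℝ) * (b / n * Real.log y) = b * Real.log y := by field_simp
    linear_combination e1 + e2
  simp only [mul_negMulLog_div hn'] at hrate
  have key : a * Real.log x + b * Real.log y + Real.log (expectedPairs d n a b)
      - n * rate d x y (a / n) (b / n) = 2 * stirlingError n - stirlingError a
        - stirlingError (n - a) - stirlingError b - stirlingError (n - b)
        + d * (stirlingError (n - b) + stirlingError (n - a) - stirlingError (n - a - b)
          - stirlingError n) := by
    rw [hrate, log_expectedPairs d h]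
    simp only [stirlingError]
    rw [Nat.cast_sub (show b ≤ n - a by omega), Nat.cast_sub (show a ≤ n by omega),
      Nat.cast_sub (show b ≤ n by omega)]
    ring
  rw [key]
  have l1 := stirlingError_nonneg n
  have l2 := stirlingError_nonneg a
  have l3 := stirlingError_nonneg (n - a)
  have l4 := stirlingError_nonneg b
  have l5 := stirlingError_nonneg (n - b)
  have l6 := stirlingError_nonneg (n - a - b)
  have u1 := stirlingError_le_of_le (le_refl n)
  have u2 := stirlingError_le_of_le (show a ≤ n by omega)
  have u3 := stirlingError_le_of_le (show n - a ≤ n by omega)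
  have u4 := stirlingError_le_of_le (show b ≤ n by omega)
  have u5 := stirlingError_le_of_le (show n - b ≤ n by omega)
  have u6 := stirlingError_le_of_le (show n - a - b ≤ n by omega)
  set ℓ := Real.log ((n : ℝ) + 1) + 1
  have hd : (0 : ℝ) ≤ d := Nat.cast_nonneg d
  have hin : |stirlingError (n - b) + stirlingError (n - a) - stirlingError (n - a - b)
      - stirlingError n| ≤ 4 * ℓ := by
    rw [abs_le]
    constructor <;> linarith
  have hin' := mul_le_mul_of_nonneg_left hin hd
  rw [← abs_of_nonneg hd, ← abs_mul, abs_of_nonneg hd, abs_le] at hin'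
  rw [abs_le]
  constructor <;> linarith [hin'.1, hin'.2]

lemma tendsto_log_add_one_div (C : ℝ) :
    Tendsto (fun n : ℕ => C * (Real.log (n + 1) + 1) / n) atTop (𝓝 0) := by
  have h0 : Tendsto (fun n : ℕ => ((n : ℝ) + 1)) atTop atTop :=
    tendsto_atTop_add_const_right _ _ tendsto_natCast_atTop_atTop
  have h1 : Tendsto (fun n : ℕ => Real.log ((n : ℝ) + 1) / ((n : ℝ) + 1)) atTop (𝓝 0) :=
    (Real.isLittleO_log_id_atTop.tendsto_div_nhds_zero).comp h0
  have h2 : Tendsto (fun n : ℕ => (1 : ℝ) / n) atTop (𝓝 0) := tendsto_one_div_atTop_nhds_zero_nat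
  have h3 : Tendsto (fun n : ℕ => C * (Real.log ((n : ℝ) + 1) / ((n : ℝ) + 1) * (1 + 1 / n)
      + 1 / n)) atTop (𝓝 0) := by
    have := ((h1.mul (h2.const_add 1)).add h2).const_mul C
    simpa using this
  refine h3.congr' ?_
  filter_upwards [eventually_gt_atTop 0] with n hn
  have : (0 : ℝ) < n := by exact_mod_cast hn
  field_simp

/-- The partition function of every union of `d` perfect matchings is at least the exponential of
the rate function at every admissible point. -/
theorem exp_rate_le_pairZ {n d : ℕ} (σ : Fin d → Equiv.Perm (Fin n)) (hd : 0 < d) {x y : ℝ}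
    (hx : 0 < x) (hy : 0 < y) {α β : ℝ} (hα : 0 ≤ α) (hβ : 0 ≤ β) (hαβ : α + β ≤ 1) :
    Real.exp (n * rate d x y α β) ≤ pairZ σ x y := by
  have hZ : 0 < pairZ σ x y := by
    rw [← sum_baseWeight]
    exact Finset.sum_pos (fun z _ => baseWeight_pos σ hx hy z) Finset.univ_nonempty
  rw [← Real.le_log_iff_exp_le hZ]
  set C : ℝ := 6 + 4 * d
  -- The base size n stays fixed while the lift order M grows; after division by M the Stirling
  -- error disappears and the rounded densities converge.
  have hfloor : ∀ γ : ℝ, 0 ≤ γ →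
      Tendsto (fun M : ℕ => (⌊γ * M⌋₊ : ℝ) / M) atTop (𝓝 γ) := fun γ hγ =>
    (tendsto_nat_floor_mul_div_atTop hγ).comp (tendsto_natCast_atTop_atTop (R := ℝ))
  have hrate : Tendsto (fun M : ℕ => rate d x y ((⌊α * M⌋₊ : ℝ) / M) ((⌊β * M⌋₊ : ℝ) / M))
      atTop (𝓝 (rate d x y α β)) :=
    Tendsto.comp (g := fun p : ℝ × ℝ => rate d x y p.1 p.2)
      (f := fun M : ℕ => ((⌊α * M⌋₊ : ℝ) / M, (⌊β * M⌋₊ : ℝ) / M))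
      ((continuous_rate d x y).tendsto (α, β)) ((hfloor α hα).prodMk_nhds (hfloor β hβ))
  have hlim := (hrate.sub (tendsto_log_add_one_div C)).const_mul (n : ℝ)
  rw [sub_zero] at hlim
  refine le_of_tendsto hlim ?_
  filter_upwards [eventually_gt_atTop 0] with M hM
  have hM' : (0 : ℝ) < M := by exact_mod_cast hM
  set a := ⌊α * M⌋₊
  set b := ⌊β * M⌋₊
  have hab : a + b ≤ M := by
    have h1 : (a : ℝ) ≤ α * M := Nat.floor_le (by positivity)
    have h2 : (b : ℝ) ≤ β * M := Nat.floor_le (by positivity)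
    have h3 : (α + β) * M ≤ 1 * M := mul_le_mul_of_nonneg_right hαβ hM'.le
    have : ((a + b : ℕ) : ℝ) ≤ M := by push_cast; linarith
    exact_mod_cast this
  have hE := expectedPairs_pos d hab
  have h1 := Real.log_le_log (by positivity) (expectedPairs_pow_le_pairZ_pow σ hd hx hy M a b)
  rw [Real.log_pow, Real.log_pow, Real.log_mul (by positivity) hE.ne',
    Real.log_mul (by positivity) (by positivity), Real.log_pow, Real.log_pow] at h1
  have h2 := (abs_le.1 (abs_log_expectedPairs_sub_le d hM hab x y)).1
  have h3 : (M : ℝ) * (n * (rate d x y (a / M) (b / M) - C * (Real.log (M + 1) + 1) / M)) =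
      n * (M * rate d x y (a / M) (b / M) - C * (Real.log (M + 1) + 1)) := by
    field_simp
  refine le_of_mul_le_mul_left ?_ hM'
  rw [h3]
  refine le_trans ?_ h1
  refine mul_le_mul_of_nonneg_left ?_ (Nat.cast_nonneg n)
  linarith

/-! ### Maximizers of the rate above the critical activity -/

/-- The admissible pairs of densities. -/
def densities : Set (ℝ × ℝ) := {p | 0 ≤ p.1 ∧ 0 ≤ p.2 ∧ p.1 + p.2 ≤ 1}

lemma isCompact_densities : IsCompact densities := by
  have hsub : densities ⊆ Set.Icc (0 : ℝ) 1 ×ˢ Set.Icc (0 : ℝ) 1 := by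
    rintro ⟨a, b⟩ ⟨h1, h2, h3⟩
    simp only at h1 h2 h3
    exact ⟨⟨h1, by simp only; linarith⟩, ⟨h2, by simp only; linarith⟩⟩
  refine (isCompact_Icc.prod isCompact_Icc).of_isClosed_subset ?_ hsub
  exact (isClosed_le continuous_const continuous_fst).inter
    ((isClosed_le continuous_const continuous_snd).inter
      (isClosed_le (continuous_fst.add continuous_snd) continuous_const))

lemma lamCrit_pos {d : ℕ} (hd : 3 ≤ d) : 0 < lamCrit d := by
  have : (3 : ℝ) ≤ d := by exact_mod_cast hd
  have h1 : (0 : ℝ) < (d : ℝ) - 1 := by linarith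
  have h2 : (0 : ℝ) < (d : ℝ) - 2 := by linarith
  unfold lamCrit
  positivity

/-- With the right side empty, the left vertices are free and have total weight (1 + λ)^n. This
point beats both ends of the diagonal. -/
lemma rate_left_only (d : ℕ) {lam : ℝ} (hl : 0 < lam) :
    rate d lam lam (lam / (1 + lam)) 0 = Real.log (1 + lam) := by
  have h1 : 1 - lam / (1 + lam) = 1 / (1 + lam) := by field_simp; ring
  have h2 : 0 < 1 + lam := by linarith
  rw [rate, sub_zero, sub_zero, h1]
  simp only [Real.negMulLog, Real.log_one, Real.log_zero]
  rw [Real.log_div hl.ne' h2.ne', Real.log_div one_ne_zero h2.ne', Real.log_one]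
  field_simp
  ring

lemma hasDerivAt_negMulLog_comp {f : ℝ → ℝ} {f' t : ℝ} (hf : HasDerivAt f f' t) (h : f t ≠ 0) :
    HasDerivAt (fun s => Real.negMulLog (f s)) ((-Real.log (f t) - 1) * f') t :=
  (Real.hasDerivAt_negMulLog h).comp t hf

lemma hasDerivAt_rate_diagonal (d : ℕ) (lam : ℝ) {α : ℝ} (h0 : 0 < α) (h1 : α < 1 / 2) :
    HasDerivAt (fun t => rate d lam lam t t)
      (2 * (Real.log lam - Real.log α - ((d : ℝ) - 1) * Real.log (1 - α)
        + d * Real.log (1 - α - α))) α := by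
  have hid := hasDerivAt_id' α
  have e1 := hasDerivAt_negMulLog_comp hid h0.ne'
  have e2 := hasDerivAt_negMulLog_comp (hid.const_sub 1) (by linarith : (1 : ℝ) - α ≠ 0)
  have e3 := hasDerivAt_negMulLog_comp ((hid.const_sub 1).sub hid)
    (show (1 : ℝ) - α - α ≠ 0 by intro h; linarith)
  have e4 := hid.mul_const (Real.log lam)
  have := ((((e4.add e4).add e1).add e1).sub ((e2.add e2).const_mul ((d : ℝ) - 1))).add
    (e3.const_mul (d : ℝ))
  refine (this.congr_deriv ?_)
  simp only [Pi.sub_apply]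
  ring

/-- The value of λ for which α is stationary on the diagonal equals λ_c at α = 1/d. Below that it is
controlled by α(d-2) ≤ 1-2α and (1-α)(d-2) ≤ (d-1)(1-2α), both equivalent to αd ≤ 1; the second is
used d - 1 times. -/
lemma log_le_log_lamCrit {d : ℕ} (hd : 3 ≤ d) {α : ℝ} (h0 : 0 < α) (hα : α * d ≤ 1) :
    Real.log α + ((d : ℝ) - 1) * Real.log (1 - α) - d * Real.log (1 - α - α)
      ≤ Real.log (lamCrit d) := by
  have hd' : (3 : ℝ) ≤ d := by exact_mod_cast hd
  have hα3 : α * 3 ≤ 1 := (mul_le_mul_of_nonneg_left hd' h0.le).trans hα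
  have p1 : 0 < (d : ℝ) - 1 := by linarith
  have p2 : 0 < (d : ℝ) - 2 := by linarith
  have p3 : 0 < 1 - α := by linarith
  have p4 : 0 < 1 - α - α := by linarith
  have e1 : Real.log (α * (d - 2)) ≤ Real.log (1 - α - α) :=
    Real.log_le_log (by positivity) (by linarith)
  have e2 : Real.log ((1 - α) * (d - 2)) ≤ Real.log ((d - 1) * (1 - α - α)) :=
    Real.log_le_log (by positivity) (by linarith)
  rw [Real.log_mul h0.ne' p2.ne'] at e1
  rw [Real.log_mul p3.ne' p2.ne', Real.log_mul p1.ne' p4.ne'] at e2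
  have e3 := mul_le_mul_of_nonneg_left e2 p1.le
  rw [lamCrit, Real.log_div (by positivity) (by positivity), Real.log_pow, Real.log_pow,
    Nat.cast_sub (by omega)]
  push_cast
  linarith

lemma hasDerivAt_rate_antidiagonal (d : ℕ) (lam : ℝ) {α t : ℝ} (h1 : 0 < α + t) (h2 : 0 < α - t)
    (h3 : 0 < 1 - (α + t)) (h4 : 0 < 1 - (α - t)) :
    HasDerivAt (fun t => rate d lam lam (α + t) (α - t))
      (Real.log (α - t) - Real.log (α + t) - ((d : ℝ) - 1) *
        (Real.log (1 - (α + t)) - Real.log (1 - (α - t)))) t := by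
  have hid := hasDerivAt_id' t
  have ha := hid.const_add α
  have hb := hid.const_sub α
  have e1 := hasDerivAt_negMulLog_comp ha h1.ne'
  have e2 := hasDerivAt_negMulLog_comp hb h2.ne'
  have e3 := hasDerivAt_negMulLog_comp (ha.const_sub 1) h3.ne'
  have e4 := hasDerivAt_negMulLog_comp (hb.const_sub 1) h4.ne'
  have e5 := ha.mul_const (Real.log lam)
  have e6 := hb.mul_const (Real.log lam)
  have := ((((e5.add e6).add e1).add e2).sub ((e3.add e4).const_mul ((d : ℝ) - 1))).add_const
    (d * Real.negMulLog (1 - α - α))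
  refine (this.congr_deriv ?_).congr_of_eventuallyEq (Eventually.of_forall fun s => ?_)
  · ring
  · have : 1 - (α + s) - (α - s) = 1 - α - α := by ring
    simp only [rate, this]
    rfl

/-- Across the diagonal the first derivative vanishes and the second is 2(αd-1)/(α(1-α)) > 0, so t =
0 is a local minimum. Were it also a local maximum, the function would be locally constant. -/
lemma exists_rate_antidiagonal_gt (d : ℕ) (lam : ℝ) {α : ℝ} (h0 : 0 < α) (h1 : α < 1 / 2)
    (hα : 1 < α * d) {s : Set ℝ} (hs : s ∈ 𝓝 (0 : ℝ)) :
    ∃ t ∈ s, rate d lam lam α α < rate d lam lam (α + t) (α - t) := by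
  by_contra! hcon
  set ψ : ℝ → ℝ := fun t => rate d lam lam (α + t) (α - t) with hψ
  set D : ℝ → ℝ := fun t => Real.log (α - t) - Real.log (α + t) - ((d : ℝ) - 1) *
        (Real.log (1 - (α + t)) - Real.log (1 - (α - t))) with hD
  have hψ0 : ψ 0 = rate d lam lam α α := by simp [hψ]
  have hmax : IsLocalMax ψ 0 := by
    filter_upwards [hs] with t ht
    rw [hψ0]
    exact hcon t ht
  have hder : ∀ᶠ t in 𝓝 (0 : ℝ), HasDerivAt ψ (D t) t := by
    have hmem : Set.Ioo (-α) α ∈ 𝓝 (0 : ℝ) := Ioo_mem_nhds (by linarith) h0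
    filter_upwards [hmem] with t ht
    exact hasDerivAt_rate_antidiagonal d lam (by linarith [ht.1]) (by linarith [ht.2])
      (by linarith [ht.2]) (by linarith [ht.1])
  have hderiv : deriv ψ =ᶠ[𝓝 0] D := hder.mono fun t ht => ht.deriv
  set c : ℝ := -(2 / α) + ((d : ℝ) - 1) * (2 / (1 - α)) with hc
  have hD' : HasDerivAt D c 0 := by
    have hid := hasDerivAt_id' (0 : ℝ)
    have ha := hid.const_add α
    have hb := hid.const_sub α
    have e1 := hb.log (by simpa using h0.ne')
    have e2 := ha.log (by simpa using h0.ne')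
    have e3 := (ha.const_sub 1).log (by simp; intro h; linarith)
    have e4 := (hb.const_sub 1).log (by simp; intro h; linarith)
    refine ((e1.sub e2).sub ((e3.sub e4).const_mul ((d : ℝ) - 1))).congr_deriv ?_
    simp only [sub_zero, add_zero, hc]
    ring
  have hdd : deriv (deriv ψ) 0 = c := by
    rw [hderiv.deriv_eq]
    exact hD'.deriv
  have hcpos : 0 < c := by
    have h1' : 0 < 1 - α := by linarith
    have : c = 2 * (α * d - 1) / (α * (1 - α)) := by
      rw [hc]
      field_simp
      ring
    rw [this]
    have : 0 < α * d - 1 := by linarith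
    positivity
  have hmin : IsLocalMin ψ 0 := by
    refine isLocalMin_of_deriv_deriv_pos (by rw [hdd]; exact hcpos) ?_
      hder.self_of_nhds.continuousAt
    rw [hder.self_of_nhds.deriv]
    simp [hD]
  have hconst : ψ =ᶠ[𝓝 0] fun _ => ψ 0 := by
    filter_upwards [hmax, hmin] with t ht1 ht2
    exact le_antisymm ht1 ht2
  have h2 : deriv (deriv ψ) 0 = 0 := by
    rw [hconst.deriv.deriv_eq]
    simp
  rw [hdd] at h2
  linarith

/-- Above the critical activity, no point of the diagonal maximizes the rate. -/
lemma exists_rate_gt_diagonal {d : ℕ} (hd : 3 ≤ d) {lam : ℝ} (hl : lamCrit d < lam) {α : ℝ}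
    (h0 : 0 ≤ α) (h1 : α ≤ 1 / 2) :
    ∃ p ∈ densities, rate d lam lam α α < rate d lam lam p.1 p.2 := by
  have hlam : 0 < lam := (lamCrit_pos hd).trans hl
  have hd' : (3 : ℝ) ≤ d := by exact_mod_cast hd
  have hmem : (lam / (1 + lam), (0 : ℝ)) ∈ densities := by
    refine ⟨by positivity, le_refl _, ?_⟩
    simp only [add_zero]
    rw [div_le_one (by positivity)]
    linarith
  rcases h0.eq_or_lt with rfl | h0
  · refine ⟨_, hmem, ?_⟩
    simp only [rate_left_only d hlam]
    have : rate d lam lam 0 0 = 0 := by simp [rate]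
    rw [this]
    exact Real.log_pos (by linarith)
  rcases h1.eq_or_lt with rfl | h1
  · refine ⟨_, hmem, ?_⟩
    simp only [rate_left_only d hlam]
    have h2 : rate d lam lam (1 / 2) (1 / 2) = Real.log lam - ((d : ℝ) - 2) * Real.log 2 := by
      have e : (1 : ℝ) - 1 / 2 = 1 / 2 := by norm_num
      have e' : Real.negMulLog (1 / 2) = 1 / 2 * Real.log 2 := by
        rw [Real.negMulLog, one_div, Real.log_inv]
        ring
      rw [rate, e, sub_self, e']
      simp only [Real.negMulLog_zero]
      ring
    rw [h2]
    have h3 : Real.log lam < Real.log (1 + lam) := Real.log_lt_log hlam (by linarith)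
    have h4 : 0 ≤ ((d : ℝ) - 2) * Real.log 2 :=
      mul_nonneg (by linarith) (Real.log_nonneg (by norm_num))
    linarith
  by_contra! hcon
  have hloc : IsLocalMax (fun t => rate d lam lam t t) α := by
    filter_upwards [Ioo_mem_nhds h0 h1] with t ht
    exact hcon (t, t) ⟨ht.1.le, ht.1.le, by simp only; linarith [ht.2]⟩
  have hcrit := hloc.hasDerivAt_eq_zero (hasDerivAt_rate_diagonal d lam h0 h1)
  have hα : 1 < α * d := by
    by_contra! hle
    have h2 := log_le_log_lamCrit hd h0 hle
    have h3 := Real.log_lt_log (lamCrit_pos hd) hl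
    linarith
  obtain ⟨t, ht, hlt⟩ := exists_rate_antidiagonal_gt d lam h0 h1 hα
    (Ioo_mem_nhds (by linarith : -α < 0) h0)
  refine absurd hlt (not_lt.2 (hcon (α + t, α - t) ⟨?_, ?_, ?_⟩)) <;> simp only <;>
    linarith [ht.1, ht.2]

/-- Above the critical activity, the rate is maximized away from the diagonal, and is bounded
away from its maximum near the diagonal. -/
theorem exists_rate_gap {d : ℕ} (hd : 3 ≤ d) {lam : ℝ} (hl : lamCrit d < lam) :
    ∃ α β δ η : ℝ, 0 ≤ α ∧ 0 ≤ β ∧ α + β ≤ 1 ∧ 0 < δ ∧ 0 < η ∧ δ ≤ α - β ∧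
      (∀ p ∈ densities, rate d lam lam p.1 p.2 ≤ rate d lam lam α β) ∧
      ∀ p ∈ densities, |p.1 - p.2| ≤ δ →
        rate d lam lam p.1 p.2 ≤ rate d lam lam α β - 4 * η := by
  have hcont := continuous_rate d lam lam
  obtain ⟨q, hq, hqmax⟩ := isCompact_densities.exists_isMaxOn
    ⟨(0, 0), le_refl _, le_refl _, by norm_num⟩ hcont.continuousOn
  set diag : Set (ℝ × ℝ) := densities ∩ {p | p.1 = p.2}
  have hdiag : IsCompact diag :=
    isCompact_densities.inter_right (isClosed_eq continuous_fst continuous_snd)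
  obtain ⟨s, hs, hsmax⟩ := hdiag.exists_isMaxOn
    ⟨(0, 0), ⟨le_refl _, le_refl _, by norm_num⟩, rfl⟩ hcont.continuousOn
  have hlt : rate d lam lam s.1 s.2 < rate d lam lam q.1 q.2 := by
    obtain ⟨⟨s0, -, s1⟩, hs2⟩ := hs
    have hs2 : s.1 = s.2 := hs2
    obtain ⟨p, hp, hp'⟩ := exists_rate_gt_diagonal hd hl (α := s.1) s0
      (by rw [← hs2] at s1; linarith)
    rw [← hs2]
    exact hp'.trans_le (hqmax hp)
  -- With `c` halfway between the diagonal maximum and the global one, the compact superlevel set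
  -- misses the diagonal and so keeps a positive distance from it. `δ` is half the least imbalance
  -- there, and 4η is the global maximum minus `c`.
  set c := (rate d lam lam s.1 s.2 + rate d lam lam q.1 q.2) / 2 with hc
  set C : Set (ℝ × ℝ) := densities ∩ {p | c ≤ rate d lam lam p.1 p.2}
  have hC : IsCompact C := isCompact_densities.inter_right (isClosed_le continuous_const hcont)
  obtain ⟨w, hw, hwmin⟩ := hC.exists_isMinOn (f := fun p => |p.1 - p.2|)
    ⟨q, hq, show c ≤ rate d lam lam q.1 q.2 by rw [hc]; linarith⟩
    (Continuous.continuousOn (by fun_prop))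
  have hwpos : 0 < |w.1 - w.2| := by
    rw [abs_pos]
    intro h0
    have h1 : rate d lam lam w.1 w.2 ≤ rate d lam lam s.1 s.2 := hsmax ⟨hw.1, sub_eq_zero.1 h0⟩
    have h2 : c ≤ rate d lam lam w.1 w.2 := hw.2
    rw [hc] at h2
    linarith
  set δ := |w.1 - w.2| / 2 with hδ
  set η := (rate d lam lam q.1 q.2 - c) / 4 with hη
  have hηpos : 0 < η := by rw [hη, hc]; linarith
  have hgap : ∀ p ∈ densities, |p.1 - p.2| ≤ δ →
      rate d lam lam p.1 p.2 ≤ rate d lam lam q.1 q.2 - 4 * η := by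
    intro p hp hpδ
    by_contra! hcon
    have h1 : |w.1 - w.2| ≤ |p.1 - p.2| :=
      hwmin ⟨hp, show c ≤ rate d lam lam p.1 p.2 by rw [hη] at hcon; linarith⟩
    rw [hδ] at hpδ
    linarith
  have hqδ : δ < |q.1 - q.2| := by
    by_contra! hcon
    have := hgap q hq hcon
    linarith
  -- By symmetry of the rate the maximizer can be taken left-heavy.
  rcases le_total q.2 q.1 with h | h
  · refine ⟨q.1, q.2, δ, η, hq.1, hq.2.1, hq.2.2, by positivity, hηpos, ?_, fun p hp => hqmax hp,
      hgap⟩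
    rw [abs_of_nonneg (by linarith)] at hqδ
    exact hqδ.le
  · refine ⟨q.2, q.1, δ, η, hq.2.1, hq.1, by linarith [hq.2.2], by positivity, hηpos, ?_, ?_, ?_⟩
    · rw [abs_of_nonpos (by linarith)] at hqδ
      linarith
    · rw [rate_comm d lam q.2]
      exact fun p hp => hqmax hp
    · rw [rate_comm d lam q.2]
      exact hgap

/-! ### Bottleneck bound for reversible chains -/

section Bottleneck

variable {S : Type*} [Fintype S] [DecidableEq S]

lemma sum_sub_le_tvDist {p q : S → ℝ} (h : ∑ x, p x = ∑ x, q x) (T : Finset S) :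
    ∑ x ∈ T, (q x - p x) ≤ tvDist p q := by
  have h1 : ∑ x ∈ T, (q x - p x) + ∑ x ∈ Tᶜ, (q x - p x) = 0 := by
    rw [Finset.sum_add_sum_compl, Finset.sum_sub_distrib, h, sub_self]
  have h2 : ∑ x ∈ T, |p x - q x| + ∑ x ∈ Tᶜ, |p x - q x| = ∑ x, |p x - q x| :=
    Finset.sum_add_sum_compl _ _
  have h3 : ∑ x ∈ T, (q x - p x) ≤ ∑ x ∈ T, |p x - q x| :=
    Finset.sum_le_sum fun x _ => by rw [abs_sub_comm]; exact le_abs_self _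
  have h4 : -∑ x ∈ Tᶜ, (q x - p x) ≤ ∑ x ∈ Tᶜ, |p x - q x| := by
    rw [← Finset.sum_neg_distrib]
    exact Finset.sum_le_sum fun x _ => by rw [neg_sub]; exact le_abs_self _
  rw [tvDist]
  linarith

variable {P : Matrix S S ℝ} {μ : S → ℝ}

lemma IsReversibleChain.sum_mul_eq (hP : IsReversibleChain P μ) (y : S) :
    ∑ x, μ x * P x y = μ y := by
  rw [Finset.sum_congr rfl fun x _ => hP.2 x y, ← Finset.mul_sum,
    Matrix.sum_row_of_mem_rowStochastic hP.1, mul_one]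

/-- A reversible chain that can leave `A` only through `N` has mixing time at least
`μ(A) / (4 μ(N))`. -/
theorem IsReversibleChain.le_mul_of_tvDist_le (hP : IsReversibleChain P μ) (hμ : ∀ x, 0 ≤ μ x)
    (hμ1 : ∑ x, μ x = 1) {A N : Finset S} (hA : ∑ x ∈ A, μ x ≤ 1 / 2)
    (hAN : ∀ x ∈ A, ∀ y ∉ A, P x y ≠ 0 → y ∈ N) {t : ℕ}
    (ht : ∀ x, tvDist ((P ^ t) x) μ ≤ 1 / (2 * Real.exp 1)) :
    (∑ x ∈ A, μ x) / 4 ≤ t * ∑ x ∈ N, μ x := by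
  have hP0 : ∀ x y, 0 ≤ P x y := fun x y => Matrix.nonneg_of_mem_rowStochastic hP.1
  have hP1 : ∀ x, ∑ y, P x y = 1 := fun x => Matrix.sum_row_of_mem_rowStochastic hP.1 x
  -- The unnormalized law of the chain started from `μ` restricted to `A`. It stays below `μ`, so in
  -- each step it loses from `A` at most the stationary flow out of `A`.
  set m : ℕ → S → ℝ := fun s y => ∑ x ∈ A, μ x * (P ^ s) x y with hm
  have hpow : ∀ s, P ^ s ∈ Matrix.rowStochastic ℝ S := fun s => pow_mem hP.1 s
  have hm0 : ∀ s y, 0 ≤ m s y := fun s y => Finset.sum_nonneg fun x _ =>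
    mul_nonneg (hμ x) (Matrix.nonneg_of_mem_rowStochastic (hpow s))
  have hstep : ∀ s y, m (s + 1) y = ∑ x, m s x * P x y := by
    intro s y
    simp only [hm, pow_succ, Matrix.mul_apply, Finset.mul_sum, Finset.sum_mul]
    rw [Finset.sum_comm]
    exact Finset.sum_congr rfl fun _ _ => Finset.sum_congr rfl fun _ _ => by ring
  have hmle : ∀ s y, m s y ≤ μ y := by
    intro s
    induction s with
    | zero =>
      intro y
      simp only [hm, pow_zero, Matrix.one_apply, mul_ite, mul_one, mul_zero,
        Finset.sum_ite_eq']
      split_ifs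
      · exact le_refl _
      · exact hμ y
    | succ s ih =>
      intro y
      rw [hstep, ← hP.sum_mul_eq y]
      exact Finset.sum_le_sum fun x _ => mul_le_mul_of_nonneg_right (ih x) (hP0 x y)
  have hflow : ∑ x ∈ A, ∑ y ∈ Aᶜ, μ x * P x y ≤ ∑ y ∈ N, μ y := by
    calc ∑ x ∈ A, ∑ y ∈ Aᶜ, μ x * P x y ≤ ∑ x ∈ A, ∑ y ∈ N, μ x * P x y := by
          refine Finset.sum_le_sum fun x hx => ?_
          rw [← Finset.sum_filter_ne_zero (s := Aᶜ)]
          refine Finset.sum_le_sum_of_subset_of_nonneg (fun y hy => ?_)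
            fun y _ _ => mul_nonneg (hμ x) (hP0 x y)
          rw [Finset.mem_filter, Finset.mem_compl] at hy
          exact hAN x hx y hy.1 (right_ne_zero_of_mul hy.2)
      -- Detailed balance reverses the flow, which is then bounded by the mass of its target `N`.
      _ = ∑ y ∈ N, μ y * ∑ x ∈ A, P y x := by
          rw [Finset.sum_comm]
          refine Finset.sum_congr rfl fun y _ => ?_
          rw [Finset.mul_sum]
          exact Finset.sum_congr rfl fun x _ => hP.2 x y
      _ ≤ ∑ y ∈ N, μ y := by
          refine Finset.sum_le_sum fun y _ => mul_le_of_le_one_right (hμ y) ?_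
          rw [← hP1 y]
          exact Finset.sum_le_sum_of_subset_of_nonneg (Finset.subset_univ _)
            fun x _ _ => hP0 y x
  have hleave : ∀ s : ℕ, ∑ y ∈ Aᶜ, m s y ≤ s * ∑ x ∈ N, μ x := by
    intro s
    induction s with
    | zero =>
      simp only [Nat.cast_zero, zero_mul]
      refine (Finset.sum_eq_zero fun y hy => ?_).le
      simp only [hm, pow_zero, Matrix.one_apply, mul_ite, mul_one, mul_zero, Finset.sum_ite_eq']
      rw [if_neg (Finset.mem_compl.1 hy)]
    | succ s ih =>
      have h1 : ∑ y ∈ Aᶜ, m (s + 1) y =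
          ∑ x ∈ A, ∑ y ∈ Aᶜ, m s x * P x y + ∑ x ∈ Aᶜ, ∑ y ∈ Aᶜ, m s x * P x y := by
        rw [Finset.sum_add_sum_compl A fun x => ∑ y ∈ Aᶜ, m s x * P x y,
          Finset.sum_congr rfl fun y _ => hstep s y]
        exact Finset.sum_comm
      have h2 : ∑ x ∈ A, ∑ y ∈ Aᶜ, m s x * P x y ≤ ∑ x ∈ A, ∑ y ∈ Aᶜ, μ x * P x y :=
        Finset.sum_le_sum fun x _ => Finset.sum_le_sum fun y _ =>
          mul_le_mul_of_nonneg_right (hmle s x) (hP0 x y)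
      have h3 : ∑ x ∈ Aᶜ, ∑ y ∈ Aᶜ, m s x * P x y ≤ ∑ x ∈ Aᶜ, m s x := by
        refine Finset.sum_le_sum fun x _ => ?_
        rw [← Finset.mul_sum]
        refine mul_le_of_le_one_right (hm0 s x) ?_
        rw [← hP1 x]
        exact Finset.sum_le_sum_of_subset_of_nonneg (Finset.subset_univ _) fun y _ _ => hP0 x y
      rw [h1]
      push_cast
      linarith
  refine le_trans ?_ (hleave t)
  -- The complement of `A` has mass at least 1/2, so by e ≥ 2 a mixed chain puts at least 1/4 there
  -- from every start.
  have hexp : 1 / (2 * Real.exp 1) ≤ (1 : ℝ) / 4 := by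
    refine one_div_le_one_div_of_le (by norm_num) ?_
    linarith [Real.add_one_le_exp (1 : ℝ)]
  have hAc : 1 / 2 ≤ ∑ y ∈ Aᶜ, μ y := by
    have := Finset.sum_add_sum_compl A μ
    linarith
  have hx : ∀ x, 1 / 4 ≤ ∑ y ∈ Aᶜ, (P ^ t) x y := by
    intro x
    have h1 := sum_sub_le_tvDist (p := (P ^ t) x) (q := μ)
      ((Matrix.sum_row_of_mem_rowStochastic (hpow t) x).trans hμ1.symm) Aᶜ
    rw [Finset.sum_sub_distrib] at h1
    have h2 := ht x
    linarith
  calc (∑ x ∈ A, μ x) / 4 = ∑ x ∈ A, μ x * (1 / 4) := by rw [← Finset.sum_mul]; ring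
    _ ≤ ∑ x ∈ A, μ x * ∑ y ∈ Aᶜ, (P ^ t) x y :=
        Finset.sum_le_sum fun x _ => mul_le_mul_of_nonneg_left (hx x) (hμ x)
    _ = ∑ y ∈ Aᶜ, m t y := by
        simp only [Finset.mul_sum, hm]
        rw [Finset.sum_comm]

lemma ofReal_le_mixingTime {r : ℝ}
    (h : ∀ t : ℕ, (∀ x, tvDist ((P ^ t) x) μ ≤ 1 / (2 * Real.exp 1)) → r ≤ t) :
    ENNReal.ofReal r ≤ (mixingTime P μ : ENNReal) := by
  have h1 : ((⌈r⌉₊ : ℕ) : ℕ∞) ≤ mixingTime P μ :=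
    le_iInf₂ fun t ht => by exact_mod_cast Nat.ceil_le.2 (h t ht)
  calc ENNReal.ofReal r ≤ ENNReal.ofReal (⌈r⌉₊ : ℝ) := ENNReal.ofReal_le_ofReal (Nat.le_ceil r)
    _ = ((⌈r⌉₊ : ℕ∞) : ENNReal) := by rw [ENNReal.ofReal_natCast]; rfl
    _ ≤ _ := by exact_mod_cast h1

end Bottleneck

/-! ### Glauber dynamics as a reversible single-site chain -/

section Glauber

set_option linter.unusedSectionVars false

variable {V : Type*} [Fintype V] [DecidableEq V] {G : SimpleGraph V} {lam : ℝ}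

lemma sum_pow_card_pos (hl : 0 < lam) : 0 < ∑ J : IndepSets G, lam ^ J.1.card :=
  Finset.sum_pos (fun _ _ => pow_pos hl _) ⟨⟨∅, by simp⟩, Finset.mem_univ _⟩

lemma hardCore_nonneg (hl : 0 < lam) (I : IndepSets G) : 0 ≤ hardCore G lam I :=
  div_nonneg (pow_pos hl _).le (sum_pow_card_pos hl).le

lemma sum_hardCore (hl : 0 < lam) : ∑ I, hardCore G lam I = 1 := by
  simp only [hardCore]
  rw [← Finset.sum_div, div_self (sum_pow_card_pos hl).ne']

lemma isIndepSet_erase {I : Finset V} (hI : G.IsIndepSet (I : Set V)) (v : V) :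
    G.IsIndepSet ((I.erase v : Finset V) : Set V) :=
  hI.mono (by simp)

lemma isIndepSet_insert {I : Finset V} (hI : G.IsIndepSet (I : Set V)) {v : V}
    (hv : ∀ w, G.Adj v w → w ∉ I) : G.IsIndepSet ((insert v I : Finset V) : Set V) := by
  rw [Finset.coe_insert]
  intro a ha b hb hab
  rcases ha with rfl | ha <;> rcases hb with rfl | hb
  · exact absurd rfl hab
  · exact fun h => hv b h hb
  · exact fun h => hv a h.symm ha
  · exact hI ha hb hab

lemma sum_indicator_indepSet {I : Finset V} (hI : G.IsIndepSet (I : Set V)) :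
    ∑ J : IndepSets G, (if J.1 = I then (1 : ℝ) else 0) = 1 := by
  set I' : IndepSets G := ⟨I, hI⟩
  have h := Finset.sum_eq_single (s := Finset.univ)
    (f := fun J : IndepSets G => if J.1 = I then (1 : ℝ) else 0) I'
    (fun J _ hJ => if_neg fun h => hJ (Subtype.ext h)) fun h => absurd (Finset.mem_univ I') h
  exact h.trans (if_pos rfl)

/-- The probability of the Glauber move from `I` to `J` when the vertex `v` is updated. -/
noncomputable def glauberAt (G : SimpleGraph V) (lam : ℝ) (v : V) (I J : IndepSets G) : ℝ :=
  open Classical in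
  if ∀ w, G.Adj v w → w ∉ I.1 then
    lam / (lam + 1) * (if J.1 = insert v I.1 then 1 else 0)
      + (1 - lam / (lam + 1)) * (if J.1 = I.1.erase v then 1 else 0)
  else (if J.1 = I.1.erase v then 1 else 0)

lemma glauber_apply (I J : IndepSets G) :
    glauber G lam I J = (1 / (Fintype.card V : ℝ)) * ∑ v, glauberAt G lam v I J := by
  unfold glauber glauberAt
  congr! 4

lemma glauberAt_nonneg (hl : 0 < lam) (v : V) (I J : IndepSets G) :
    0 ≤ glauberAt G lam v I J := by
  have h1 : 0 ≤ lam / (lam + 1) := by positivity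
  have h2 : 0 ≤ 1 - lam / (lam + 1) := by
    rw [sub_nonneg, div_le_one (by positivity)]
    linarith
  unfold glauberAt
  split_ifs <;> simp [h1, h2]

lemma sum_glauberAt (v : V) (I : IndepSets G) : ∑ J, glauberAt G lam v I J = 1 := by
  unfold glauberAt
  split_ifs with h
  · rw [Finset.sum_add_distrib, ← Finset.mul_sum, ← Finset.mul_sum,
      sum_indicator_indepSet (isIndepSet_insert I.2 h),
      sum_indicator_indepSet (isIndepSet_erase I.2 v)]
    ring
  · exact sum_indicator_indepSet (isIndepSet_erase I.2 v)

lemma glauberAt_ne_zero {v : V} {I J : IndepSets G} (h : glauberAt G lam v I J ≠ 0) :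
    J.1 = I.1 ∨ (v ∉ I.1 ∧ J.1 = insert v I.1) ∨ (v ∉ J.1 ∧ I.1 = insert v J.1) := by
  have h1 : J.1 = insert v I.1 ∨ J.1 = I.1.erase v := by
    by_contra! hcon
    apply h
    unfold glauberAt
    simp [hcon.1, hcon.2]
  rcases h1 with h1 | h1 <;> by_cases hv : v ∈ I.1
  · left
    rw [h1, Finset.insert_eq_of_mem hv]
  · exact Or.inr (Or.inl ⟨hv, h1⟩)
  · right
    right
    rw [h1]
    exact ⟨Finset.notMem_erase _ _, (Finset.insert_erase hv).symm⟩
  · left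
    rw [h1, Finset.erase_eq_of_notMem hv]

/-- Adding and removing `v` have probabilities in ratio λ, which is also the ratio of the two
weights. -/
lemma glauberAt_balance_insert (hl : 0 < lam) {v : V} {I J : IndepSets G} (hv : v ∉ I.1)
    (hJ : J.1 = insert v I.1) :
    lam ^ I.1.card * glauberAt G lam v I J = lam ^ J.1.card * glauberAt G lam v J I := by
  have hne : J.1 ≠ I.1 := fun h => hv (by rw [← h, hJ]; exact Finset.mem_insert_self _ _)
  have hvJ : v ∈ J.1 := by rw [hJ]; exact Finset.mem_insert_self _ _
  have hfreeJ : ∀ w, G.Adj v w → w ∉ J.1 := fun w hw hwJ => J.2 hvJ hwJ hw.ne hw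
  have hfreeI : ∀ w, G.Adj v w → w ∉ I.1 := fun w hw hwI =>
    hfreeJ w hw (by rw [hJ]; exact Finset.mem_insert_of_mem hwI)
  have h1 : glauberAt G lam v I J = lam / (lam + 1) := by
    unfold glauberAt
    rw [if_pos hfreeI, if_pos hJ, if_neg (by rw [Finset.erase_eq_of_notMem hv]; exact hne)]
    ring
  have h2 : glauberAt G lam v J I = 1 - lam / (lam + 1) := by
    unfold glauberAt
    rw [if_pos hfreeJ, if_neg (by rw [Finset.insert_eq_of_mem hvJ]; exact hne.symm),
      if_pos (by rw [hJ, Finset.erase_insert hv])]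
    ring
  rw [h1, h2, hJ, Finset.card_insert_of_notMem hv, pow_succ]
  field_simp
  ring

lemma glauberAt_balance (hl : 0 < lam) (v : V) (I J : IndepSets G) :
    lam ^ I.1.card * glauberAt G lam v I J = lam ^ J.1.card * glauberAt G lam v J I := by
  by_cases h : glauberAt G lam v I J = 0 ∧ glauberAt G lam v J I = 0
  · rw [h.1, h.2]
    simp
  have hcase : J.1 = I.1 ∨ (v ∉ I.1 ∧ J.1 = insert v I.1) ∨ (v ∉ J.1 ∧ I.1 = insert v J.1) := by
    by_cases h1 : glauberAt G lam v I J = 0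
    · rcases glauberAt_ne_zero (fun h2 => h ⟨h1, h2⟩) with h3 | h3 | h3
      · exact Or.inl h3.symm
      · exact Or.inr (Or.inr h3)
      · exact Or.inr (Or.inl h3)
    · exact glauberAt_ne_zero h1
  rcases hcase with h1 | ⟨hv, h1⟩ | ⟨hv, h1⟩
  · rw [show J = I from Subtype.ext h1]
  · exact glauberAt_balance_insert hl hv h1
  · exact (glauberAt_balance_insert hl hv h1).symm

lemma isReversibleChain_glauber [Nonempty V] (hl : 0 < lam) :
    IsReversibleChain (glauber G lam) (hardCore G lam) := by
  refine ⟨Matrix.mem_rowStochastic_iff_sum.2 ⟨fun I J => ?_, fun I => ?_⟩, fun I J => ?_⟩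
  · rw [glauber_apply]
    exact mul_nonneg (by positivity) (Finset.sum_nonneg fun v _ => glauberAt_nonneg hl v I J)
  · simp only [glauber_apply]
    rw [← Finset.mul_sum, Finset.sum_comm, Finset.sum_congr rfl fun v _ => sum_glauberAt v I]
    simp
  · have h : lam ^ I.1.card * ∑ v, glauberAt G lam v I J =
        lam ^ J.1.card * ∑ v, glauberAt G lam v J I := by
      rw [Finset.mul_sum, Finset.mul_sum]
      exact Finset.sum_congr rfl fun v _ => glauberAt_balance hl v I J
    simp only [glauber_apply, hardCore]
    linear_combination (1 / (Fintype.card V : ℝ)) * (1 / ∑ J : IndepSets G, lam ^ J.1.card) * h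

lemma updatesAtMost_glauber : UpdatesAtMost 1 (glauber G lam) := by
  intro I J h
  rw [glauber_apply] at h
  obtain ⟨v, -, hv⟩ := Finset.exists_ne_zero_of_sum_ne_zero (right_ne_zero_of_mul h)
  have hsub : symmDiff I.1 J.1 ⊆ {v} := by
    intro w hw
    rw [Finset.mem_symmDiff] at hw
    rw [Finset.mem_singleton]
    rcases glauberAt_ne_zero hv with h1 | ⟨-, h1⟩ | ⟨-, h1⟩ <;> rw [h1] at hw
    · tauto
    · rw [Finset.mem_insert] at hw
      tauto
    · rw [Finset.mem_insert] at hw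
      tauto
  simpa using Finset.card_le_card hsub

end Glauber

/-! ### Independent sets of the matching graph as pairs -/

section Matching

variable {n d : ℕ} (σ : Fin d → Equiv.Perm (Fin n))

lemma isIndepSet_matchingGraph_iff (I : Finset (Fin n ⊕ Fin n)) :
    (matchingGraph σ).IsIndepSet (I : Set (Fin n ⊕ Fin n)) ↔
      (I.toLeft, I.toRight) ∈ indepPairs σ := by
  simp only [indepPairs, Finset.mem_filter, Finset.mem_univ, true_and, Finset.mem_toLeft,
    Finset.mem_toRight]
  constructor
  · intro h k i hi hk
    refine h hi hk (by simp) ?_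
    rw [matchingGraph, SimpleGraph.fromRel_adj]
    exact ⟨by simp, Or.inl ⟨i, k, rfl, rfl⟩⟩
  · intro h u hu v hv _ hadj
    rw [matchingGraph, SimpleGraph.fromRel_adj] at hadj
    rcases hadj.2 with ⟨i, k, rfl, rfl⟩ | ⟨i, k, rfl, rfl⟩
    · exact h k i hu hv
    · exact h k i hv hu

lemma sum_indepSets_matchingGraph (f : Finset (Fin n) × Finset (Fin n) → ℝ) :
    ∑ I : IndepSets (matchingGraph σ), f (I.1.toLeft, I.1.toRight) = ∑ p ∈ indepPairs σ, f p := by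
  refine Finset.sum_bij' (fun I _ => (I.1.toLeft, I.1.toRight))
    (fun p hp => ⟨p.1.disjSum p.2, (isIndepSet_matchingGraph_iff σ _).2 (by simpa using hp)⟩)
    ?_ ?_ ?_ ?_ ?_
  · exact fun I _ => (isIndepSet_matchingGraph_iff σ _).1 I.2
  · exact fun p _ => Finset.mem_univ _
  · exact fun I _ => Subtype.ext (Finset.toLeft_disjSum_toRight)
  · exact fun p _ => by simp
  · exact fun I _ => rfl

end Matching

/-! ### Weights of balanced and of imbalanced independent sets -/

section Weights

variable {n d : ℕ} {σ : Fin d → Equiv.Perm (Fin n)} {lam : ℝ}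

lemma pow_mul_expectedPairs_le (hn : 0 < n) (hl : 0 < lam) {a b : ℕ} (hab : a + b ≤ n) :
    lam ^ (a + b) * expectedPairs d n a b ≤
      Real.exp (n * rate d lam lam (a / n) (b / n)
        + (6 + 4 * d) * (Real.log (n + 1) + 1)) := by
  have hE := expectedPairs_pos d hab
  rw [← Real.log_le_iff_le_exp (by positivity), Real.log_mul (by positivity) hE.ne',
    Real.log_pow]
  push_cast
  have h := (abs_le.1 (abs_log_expectedPairs_sub_le d hn hab lam lam)).2
  linarith

lemma expectedPairs_eq_zero (hd : 0 < d) {a b : ℕ} (hb : b ≤ n) (hab : n < a + b) :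
    expectedPairs d n a b = 0 := by
  rw [expectedPairs, avoidProb, Nat.choose_eq_zero_of_lt (show n - b < a by omega)]
  simp [show d ≠ 0 by omega]

/-- For typical matchings, the weight of a family of independent sets that is given by the sizes
of the two parts is bounded by the maximal rate over these sizes. -/
lemma sum_indepPairs_le (hd : 0 < d) (hn : 0 < n) (hl : 0 < lam) (hσ : σ ∈ typicalMatchings n d)
    (T : ℕ → ℕ → Prop) [∀ a b, Decidable (T a b)] (r : ℝ)
    (hT : ∀ a b, a + b ≤ n → T a b → rate d lam lam (a / n) (b / n) ≤ r) :
    ∑ p ∈ indepPairs σ with T p.1.card p.2.card, lam ^ (p.1.card + p.2.card) ≤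
      Real.exp (n * r + (11 + 4 * d) * (Real.log (n + 1) + 1)) := by
  have hn1 : (0 : ℝ) < (n : ℝ) + 1 := by positivity
  set E : ℝ := Real.exp (n * r + (6 + 4 * d) * (Real.log (n + 1) + 1)) with hE
  set R := Finset.range (n + 1) ×ˢ Finset.range (n + 1) with hR
  have hmaps : ∀ p ∈ (indepPairs σ).filter (fun p => T p.1.card p.2.card),
      (p.1.card, p.2.card) ∈ R := by
    intro p _
    have h1 : p.1.card ≤ n := by simpa using p.1.card_le_univ
    have h2 : p.2.card ≤ n := by simpa using p.2.card_le_univ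
    simp only [hR, Finset.mem_product, Finset.mem_range]
    omega
  rw [← Finset.sum_fiberwise_of_maps_to hmaps]
  have hterm : ∀ q ∈ R, ∑ p ∈ (indepPairs σ).filter (fun p => T p.1.card p.2.card) with
      (p.1.card, p.2.card) = q, lam ^ (p.1.card + p.2.card) ≤ ((n : ℝ) + 1) ^ 3 * E := by
    rintro ⟨a, b⟩ hq
    simp only [hR, Finset.mem_product, Finset.mem_range] at hq
    by_cases hTab : T a b
    · have h1 : ((indepPairs σ).filter (fun p => T p.1.card p.2.card)).filter
          (fun p => (p.1.card, p.2.card) = (a, b)) =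
          (indepPairs σ).filter fun p => p.1.card = a ∧ p.2.card = b := by
        ext p
        simp only [Finset.mem_filter, Prod.mk.injEq]
        constructor
        · exact fun h => ⟨h.1.1, h.2⟩
        · rintro ⟨h1, rfl, rfl⟩
          exact ⟨⟨h1, hTab⟩, rfl, rfl⟩
      rw [h1, Finset.sum_congr rfl (g := fun _ => lam ^ (a + b)) fun p hp => by
        rw [(Finset.mem_filter.1 hp).2.1, (Finset.mem_filter.1 hp).2.2]]
      rw [Finset.sum_const, nsmul_eq_mul]
      have h2 : (numPairs σ a b : ℝ) ≤ ((n : ℝ) + 1) ^ 3 * expectedPairs d n a b :=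
        hσ a (by omega) b (by omega)
      have h3 : lam ^ (a + b) * expectedPairs d n a b ≤ E := by
        by_cases hab : a + b ≤ n
        · refine (pow_mul_expectedPairs_le hn hl hab).trans (Real.exp_le_exp.2 ?_)
          have := mul_le_mul_of_nonneg_left (hT a b hab hTab) (Nat.cast_nonneg (α := ℝ) n)
          linarith
        · rw [expectedPairs_eq_zero hd (by omega) (by omega), mul_zero]
          exact (Real.exp_pos _).le
      calc (numPairs σ a b : ℝ) * lam ^ (a + b)
          ≤ ((n : ℝ) + 1) ^ 3 * expectedPairs d n a b * lam ^ (a + b) :=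
            mul_le_mul_of_nonneg_right h2 (by positivity)
        _ = ((n : ℝ) + 1) ^ 3 * (lam ^ (a + b) * expectedPairs d n a b) := by ring
        _ ≤ _ := mul_le_mul_of_nonneg_left h3 (by positivity)
    · rw [Finset.sum_eq_zero]
      · positivity
      · intro p hp
        simp only [Finset.mem_filter, Prod.mk.injEq] at hp
        obtain ⟨⟨-, h1⟩, rfl, rfl⟩ := hp
        exact absurd h1 hTab
  refine (Finset.sum_le_sum hterm).trans ?_
  -- (n + 1)^2 pairs of sizes times the typicality factor (n + 1)^3; this 5 turns the constant 6
  -- into 11.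
  have h5 : ((n : ℝ) + 1) ^ 5 = Real.exp (5 * Real.log (n + 1)) := by
    rw [mul_comm, Real.exp_mul, Real.exp_log hn1]
    norm_cast
  rw [Finset.sum_const, nsmul_eq_mul, hR, Finset.card_product, Finset.card_range]
  push_cast
  calc ((n : ℝ) + 1) * (n + 1) * ((n + 1) ^ 3 * E) = (n + 1) ^ 5 * E := by ring
    _ = Real.exp (5 * Real.log (n + 1) + (n * r + (6 + 4 * d) * (Real.log (n + 1) + 1))) := by
        rw [h5, hE, ← Real.exp_add]
    _ ≤ _ := Real.exp_le_exp.2 (by linarith)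

lemma mem_densities {a b : ℕ} (hn : 0 < n) (hab : a + b ≤ n) :
    ((a / n, b / n) : ℝ × ℝ) ∈ densities := by
  have hn' : (0 : ℝ) < n := by exact_mod_cast hn
  refine ⟨by positivity, by positivity, ?_⟩
  simp only
  rw [← add_div, div_le_one hn']
  exact_mod_cast hab

lemma rate_tilt (d : ℕ) (hl : 0 < lam) (s α β : ℝ) :
    rate d (lam * Real.exp s) (lam * Real.exp (-s)) α β =
      rate d lam lam α β + s * (α - β) := by
  rw [rate, rate, Real.log_mul hl.ne' (Real.exp_pos _).ne',
    Real.log_mul hl.ne' (Real.exp_pos _).ne', Real.log_exp, Real.log_exp]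
  ring

/-- For typical matchings, the independent sets whose imbalance `s * (|A| - |B|)` is as large as at
the maximizer of the rate carry almost the maximal weight. -/
lemma exp_le_sum_indepPairs_imbalanced (hd : 0 < d) (hn : 0 < n) (hl : 0 < lam)
    (hσ : σ ∈ typicalMatchings n d) {α β δ η s : ℝ} (hα : 0 ≤ α) (hβ : 0 ≤ β) (hαβ : α + β ≤ 1)
    (hη : 0 < η) (hs : |s| = 1) (hδ : δ ≤ s * (α - β))
    (hmax : ∀ p ∈ densities, rate d lam lam p.1 p.2 ≤ rate d lam lam α β)
    (hlarge : (11 + 4 * d) * (Real.log (n + 1) + 1) + Real.log 2 ≤ η * δ / 2 * n) :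
    Real.exp (n * (rate d lam lam α β - η)) / 2 ≤
      ∑ p ∈ indepPairs σ with δ / 2 * n < s * ((p.1.card : ℝ) - p.2.card),
        lam ^ (p.1.card + p.2.card) := by
  set R := rate d lam lam α β with hR
  set D : Finset (Fin n) × Finset (Fin n) → ℝ := fun p => s * ((p.1.card : ℝ) - p.2.card) with hD
  set w : Finset (Fin n) × Finset (Fin n) → ℝ := fun p => lam ^ (p.1.card + p.2.card) with hw
  have hw0 : ∀ p, 0 ≤ w p := fun p => by positivity
  -- The tilt raises the lower bound to at least exp(n(R + ηδ)), but raises the sets of imbalance at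
  -- most δn/2 by at most exp(ηδn/2), so these account for at most half of it. Removing the tilt
  -- from the others costs at most exp(ηn), since no imbalance exceeds n.
  have hZ := exp_rate_le_pairZ σ hd (x := lam * Real.exp (η * s))
    (y := lam * Real.exp (-(η * s))) (by positivity) (by positivity) hα hβ hαβ
  rw [rate_tilt d hl, ← hR] at hZ
  have hZ' : pairZ σ (lam * Real.exp (η * s)) (lam * Real.exp (-(η * s))) =
      ∑ p ∈ indepPairs σ, w p * Real.exp (η * D p) := by
    refine Finset.sum_congr rfl fun p _ => ?_
    simp only [hw, hD]
    rw [mul_pow, mul_pow, ← Real.exp_nat_mul, ← Real.exp_nat_mul, pow_add,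
      show η * (s * ((p.1.card : ℝ) - p.2.card)) =
        p.1.card * (η * s) + p.2.card * (-(η * s)) by ring, Real.exp_add]
    ring
  rw [hZ', ← Finset.sum_filter_add_sum_filter_not (indepPairs σ) (fun p => δ / 2 * n < D p)] at hZ
  have hDn : ∀ p, D p ≤ n := by
    intro p
    have h1 : (p.1.card : ℝ) ≤ n := by exact_mod_cast (by simpa using p.1.card_le_univ)
    have h2 : (p.2.card : ℝ) ≤ n := by exact_mod_cast (by simpa using p.2.card_le_univ)
    have h3 : (0 : ℝ) ≤ p.1.card := Nat.cast_nonneg _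
    have h4 : (0 : ℝ) ≤ p.2.card := Nat.cast_nonneg _
    calc D p ≤ |D p| := le_abs_self _
      _ = |(p.1.card : ℝ) - p.2.card| := by rw [hD]; simp only; rw [abs_mul, hs, one_mul]
      _ ≤ n := abs_le.2 ⟨by linarith, by linarith⟩
  have hA : ∑ p ∈ indepPairs σ with δ / 2 * n < D p, w p * Real.exp (η * D p) ≤
      (∑ p ∈ indepPairs σ with δ / 2 * n < D p, w p) * Real.exp (η * n) := by
    rw [Finset.sum_mul]
    exact Finset.sum_le_sum fun p _ => mul_le_mul_of_nonneg_left
      (Real.exp_le_exp.2 (mul_le_mul_of_nonneg_left (hDn p) hη.le)) (hw0 p)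
  have htotal : ∑ p ∈ indepPairs σ, w p ≤
      Real.exp (n * R + (11 + 4 * d) * (Real.log (n + 1) + 1)) := by
    have := sum_indepPairs_le hd hn hl hσ (fun _ _ => True) R
      fun a b hab _ => hmax _ (mem_densities hn hab)
    simpa only [Finset.filter_true] using this
  have hB : ∑ p ∈ indepPairs σ with ¬ δ / 2 * n < D p, w p * Real.exp (η * D p) ≤
      Real.exp (n * R + (11 + 4 * d) * (Real.log (n + 1) + 1)) * Real.exp (η * (δ / 2 * n)) := by
    calc _ ≤ ∑ p ∈ indepPairs σ with ¬ δ / 2 * n < D p, w p * Real.exp (η * (δ / 2 * n)) := by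
          refine Finset.sum_le_sum fun p hp => mul_le_mul_of_nonneg_left
            (Real.exp_le_exp.2 (mul_le_mul_of_nonneg_left ?_ hη.le)) (hw0 p)
          exact not_lt.1 (Finset.mem_filter.1 hp).2
      _ ≤ ∑ p ∈ indepPairs σ, w p * Real.exp (η * (δ / 2 * n)) :=
          Finset.sum_le_sum_of_subset_of_nonneg (Finset.filter_subset _ _)
            fun p _ _ => mul_nonneg (hw0 p) (Real.exp_pos _).le
      _ ≤ _ := by
          rw [← Finset.sum_mul]
          exact mul_le_mul_of_nonneg_right htotal (Real.exp_pos _).le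
  have hn0 : (0 : ℝ) ≤ n := Nat.cast_nonneg n
  have hB' : Real.exp (n * R + (11 + 4 * d) * (Real.log (n + 1) + 1)) *
      Real.exp (η * (δ / 2 * n)) ≤ Real.exp (n * (R + η * δ)) / 2 := by
    rw [le_div_iff₀ two_pos, ← Real.exp_add]
    calc _ = Real.exp (n * R + (11 + 4 * d) * (Real.log (n + 1) + 1) + η * (δ / 2 * n)) *
          Real.exp (Real.log 2) := by rw [Real.exp_log two_pos]
      _ ≤ _ := by
          rw [← Real.exp_add]
          refine Real.exp_le_exp.2 ?_
          linarith
  have hlow : Real.exp (n * (R + η * δ)) ≤ Real.exp (n * (R + η * s * (α - β))) := by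
    refine Real.exp_le_exp.2 (mul_le_mul_of_nonneg_left ?_ hn0)
    have := mul_le_mul_of_nonneg_left hδ hη.le
    linarith
  -- Forced by `hlarge`, whose left side is positive.
  have hδ0 : 0 ≤ η * δ := by
    by_contra! hneg
    have h1 : 0 ≤ Real.log ((n : ℝ) + 1) := Real.log_nonneg (by linarith)
    have h2 : 0 < Real.log 2 := Real.log_pos (by norm_num)
    have h3 : 0 ≤ (11 + 4 * (d : ℝ)) * (Real.log (n + 1) + 1) := by positivity
    have h4 : η * δ / 2 * n ≤ 0 := mul_nonpos_of_nonpos_of_nonneg (by linarith) hn0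
    linarith
  have hfin : Real.exp (n * (R + η * δ)) / 2 ≤
      (∑ p ∈ indepPairs σ with δ / 2 * n < D p, w p) * Real.exp (η * n) := by
    linarith
  have hexp : Real.exp (n * (R - η)) * Real.exp (η * n) ≤ Real.exp (n * (R + η * δ)) := by
    rw [← Real.exp_add]
    refine Real.exp_le_exp.2 ?_
    have := mul_nonneg hn0 hδ0
    linarith
  refine le_of_mul_le_mul_right ?_ (Real.exp_pos (η * n))
  linarith

end Weights

/-! ### From weights to mixing times -/

section MixingTime

variable {n d : ℕ} {σ : Fin d → Equiv.Perm (Fin n)} {lam : ℝ}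

lemma imbalance_sub_le (x y : Finset (Fin n ⊕ Fin n)) :
    ((x.toLeft.card : ℝ) - x.toRight.card) - ((y.toLeft.card : ℝ) - y.toRight.card) ≤
      (symmDiff x y).card := by
  have h1 : (x.toLeft \ y.toLeft).card ≤ (symmDiff x y).toLeft.card := by
    refine Finset.card_le_card fun i hi => ?_
    simp only [Finset.mem_sdiff, Finset.mem_toLeft] at hi
    simp only [Finset.mem_toLeft, Finset.mem_symmDiff]
    exact Or.inl hi
  have h2 : (y.toRight \ x.toRight).card ≤ (symmDiff x y).toRight.card := by
    refine Finset.card_le_card fun i hi => ?_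
    simp only [Finset.mem_sdiff, Finset.mem_toRight] at hi
    simp only [Finset.mem_toRight, Finset.mem_symmDiff]
    exact Or.inr hi
  have h3 := Finset.card_le_card_sdiff_add_card (s := x.toLeft) (t := y.toLeft)
  have h4 := Finset.card_le_card_sdiff_add_card (s := y.toRight) (t := x.toRight)
  have h5 := Finset.card_toLeft_add_card_toRight (u := symmDiff x y)
  have h6 : x.toLeft.card + y.toRight.card ≤
      y.toLeft.card + x.toRight.card + (symmDiff x y).card := by omega
  have h7 : (x.toLeft.card : ℝ) + y.toRight.card ≤
      y.toLeft.card + x.toRight.card + (symmDiff x y).card := by exact_mod_cast h6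
  linarith

lemma sum_hardCore_filter (T : ℕ → ℕ → Prop) [∀ a b, Decidable (T a b)] :
    ∑ I : IndepSets (matchingGraph σ) with T I.1.toLeft.card I.1.toRight.card,
      hardCore (matchingGraph σ) lam I =
    (∑ p ∈ indepPairs σ with T p.1.card p.2.card, lam ^ (p.1.card + p.2.card)) /
      ∑ J : IndepSets (matchingGraph σ), lam ^ J.1.card := by
  simp only [hardCore]
  rw [← Finset.sum_div, Finset.sum_filter, Finset.sum_filter, ← sum_indepSets_matchingGraph]
  congr 1
  refine Finset.sum_congr rfl fun I _ => ?_
  simp only [Finset.card_toLeft_add_card_toRight]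

/-- If the nearly balanced independent sets have much less weight than both the left-heavy and the
right-heavy ones, every local reversible chain mixes slowly. -/
lemma ofReal_le_mixingTime_of_weights (hl : 0 < lam) {ℓ b : ℝ} (hℓ : 0 ≤ ℓ) {k : ℕ} (hk : k ≤ ℓ)
    (hpos : ∀ s : ℝ, |s| = 1 → 0 < ∑ p ∈ indepPairs σ with
      ℓ < s * ((p.1.card : ℝ) - p.2.card), lam ^ (p.1.card + p.2.card))
    (hb : 0 < b)
    (hweight : ∀ s : ℝ, |s| = 1 →
      b * ∑ p ∈ indepPairs σ with |(p.1.card : ℝ) - p.2.card| ≤ ℓ, lam ^ (p.1.card + p.2.card) ≤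
        ∑ p ∈ indepPairs σ with ℓ < s * ((p.1.card : ℝ) - p.2.card),
          lam ^ (p.1.card + p.2.card))
    {P : Matrix (IndepSets (matchingGraph σ)) (IndepSets (matchingGraph σ)) ℝ}
    (hP : IsReversibleChain P (hardCore (matchingGraph σ) lam)) (hPk : UpdatesAtMost k P) :
    ENNReal.ofReal (1 / 4 * b) ≤
      (mixingTime P (hardCore (matchingGraph σ) lam) : ENNReal) := by
  set μ := hardCore (matchingGraph σ) lam with hμ
  set D : IndepSets (matchingGraph σ) → ℝ :=
    fun I => (I.1.toLeft.card : ℝ) - I.1.toRight.card with hD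
  set A : ℝ → Finset (IndepSets (matchingGraph σ)) :=
    fun s => Finset.univ.filter fun I => ℓ < s * D I with hA
  set N : Finset (IndepSets (matchingGraph σ)) := Finset.univ.filter fun I => |D I| ≤ ℓ with hN
  have hμ0 : ∀ I, 0 ≤ μ I := hardCore_nonneg hl
  have hμ1 : ∑ I, μ I = 1 := sum_hardCore hl
  have hZ := sum_pow_card_pos (G := matchingGraph σ) hl
  have hdisj : Disjoint (A 1) (A (-1)) := by
    rw [Finset.disjoint_left]
    intro I h1 h2
    simp only [hA, Finset.mem_filter, Finset.mem_univ, true_and] at h1 h2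
    linarith
  -- The bottleneck bound needs a set of mass at most 1/2. One of the two disjoint heavy phases
  -- qualifies, but which one is not known, so the weight bounds are required for both signs.
  obtain ⟨s, hs, hsA⟩ : ∃ s : ℝ, |s| = 1 ∧ ∑ I ∈ A s, μ I ≤ 1 / 2 := by
    by_contra! hcon
    have h1 := hcon 1 (by simp)
    have h2 := hcon (-1) (by simp)
    have h3 : ∑ I ∈ A 1, μ I + ∑ I ∈ A (-1), μ I ≤ 1 := by
      rw [← Finset.sum_union hdisj, ← hμ1]
      exact Finset.sum_le_sum_of_subset_of_nonneg (Finset.subset_univ _) fun I _ _ => hμ0 I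
    linarith
  have hμA : ∑ I ∈ A s, μ I = (∑ p ∈ indepPairs σ with ℓ < s * ((p.1.card : ℝ) - p.2.card),
      lam ^ (p.1.card + p.2.card)) / ∑ J : IndepSets (matchingGraph σ), lam ^ J.1.card :=
    sum_hardCore_filter fun a b => ℓ < s * ((a : ℝ) - b)
  have hμN : ∑ I ∈ N, μ I = (∑ p ∈ indepPairs σ with |(p.1.card : ℝ) - p.2.card| ≤ ℓ,
      lam ^ (p.1.card + p.2.card)) / ∑ J : IndepSets (matchingGraph σ), lam ^ J.1.card :=
    sum_hardCore_filter fun a b => |(a : ℝ) - b| ≤ ℓ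
  have hApos : 0 < ∑ I ∈ A s, μ I := by
    rw [hμA]
    exact div_pos (hpos s hs) hZ
  have hNA : b * ∑ I ∈ N, μ I ≤ ∑ I ∈ A s, μ I := by
    rw [hμA, hμN, ← mul_div_assoc]
    exact div_le_div_of_nonneg_right (hweight s hs) hZ.le
  -- One step changes the imbalance by at most ℓ, too little to cross the window [-ℓ, ℓ].
  have hAN : ∀ I ∈ A s, ∀ J ∉ A s, P I J ≠ 0 → J ∈ N := by
    intro I hI J hJ hIJ
    simp only [hA, hN, Finset.mem_filter, Finset.mem_univ, true_and, not_lt] at hI hJ ⊢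
    have h1 : ((symmDiff I.1 J.1).card : ℝ) ≤ ℓ :=
      le_trans (by exact_mod_cast hPk I J hIJ) hk
    have h2 : D I - D J ≤ (symmDiff I.1 J.1).card := imbalance_sub_le I.1 J.1
    have h3 : D J - D I ≤ (symmDiff J.1 I.1).card := imbalance_sub_le J.1 I.1
    rw [symmDiff_comm] at h3
    rw [abs_le]
    rcases (abs_eq zero_le_one).1 hs with rfl | rfl
    · constructor <;> linarith
    · constructor <;> linarith
  refine ofReal_le_mixingTime fun t ht => ?_
  have h := hP.le_mul_of_tvDist_le hμ0 hμ1 hsA hAN ht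
  have h1 : b * ((∑ I ∈ A s, μ I) / 4) ≤ b * (t * ∑ I ∈ N, μ I) :=
    mul_le_mul_of_nonneg_left h hb.le
  have h2 := mul_le_mul_of_nonneg_left hNA (Nat.cast_nonneg (α := ℝ) t)
  refine le_of_mul_le_mul_right ?_ hApos
  linarith

end MixingTime

/-! ### Limits in n and conclusion -/

lemma matchingProb_le_one (n d : ℕ) (E : Set (Fin d → Equiv.Perm (Fin n))) :
    matchingProb n d E ≤ 1 := by
  refine div_le_one_of_le₀ ?_ (Nat.cast_nonneg _)
  rw [← Nat.card_eq_fintype_card, ← Set.ncard_univ]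
  exact_mod_cast Set.ncard_le_ncard (Set.subset_univ E)

lemma matchingProb_mono {n d : ℕ} {E F : Set (Fin d → Equiv.Perm (Fin n))} (h : E ⊆ F) :
    matchingProb n d E ≤ matchingProb n d F := by
  refine div_le_div_of_nonneg_right ?_ (Nat.cast_nonneg _)
  exact_mod_cast Set.ncard_le_ncard h

/-- Reduces the probabilistic claims to deterministic statements about typical matchings, an event
that involves neither the chain nor the update size. -/
lemma tendsto_matchingProb_one {d : ℕ} {E : ∀ n : ℕ, Set (Fin d → Equiv.Perm (Fin n))}
    (h : ∀ᶠ n in atTop, typicalMatchings n d ⊆ E n) :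
    Tendsto (fun n => matchingProb n d (E n)) atTop (𝓝 1) := by
  have h1 : Tendsto (fun n : ℕ => 1 - 1 / ((n : ℝ) + 1)) atTop (𝓝 1) := by
    simpa using tendsto_one_div_add_atTop_nhds_zero_nat.const_sub (1 : ℝ)
  refine tendsto_of_tendsto_of_tendsto_of_le_of_le' h1 tendsto_const_nhds ?_
    (Eventually.of_forall fun n => matchingProb_le_one n d _)
  filter_upwards [h] with n hn
  exact (matchingProb_typicalMatchings_ge n d).trans (matchingProb_mono hn)

lemma eventually_log_add_le (C : ℝ) {κ : ℝ} (hκ : 0 < κ) :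
    ∀ᶠ n : ℕ in atTop, C * (Real.log (n + 1) + 1) + Real.log 2 ≤ κ * n := by
  have h1 := (tendsto_log_add_one_div C).eventually_le_const (half_pos hκ)
  have h2 : ∀ᶠ n : ℕ in atTop, Real.log 2 / (κ / 2) ≤ n :=
    tendsto_natCast_atTop_atTop.eventually_ge_atTop _
  filter_upwards [h1, h2, eventually_gt_atTop 0] with n h1 h2 hn
  have hn' : (0 : ℝ) < n := by exact_mod_cast hn
  rw [div_le_iff₀ hn'] at h1
  rw [div_le_iff₀ (half_pos hκ)] at h2
  linarith

/-- Above the critical activity, for typical matchings every reversible chain for the hard-core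
model with updates of at most `ρ n` vertices has exponential mixing time. -/
theorem exists_forall_typicalMatchings_mixingTime_ge {d : ℕ} (hd : 3 ≤ d) {lam : ℝ}
    (hl : lamCrit d < lam) :
    ∃ a : ℝ, 1 < a ∧ ∃ ρ : ℝ, 0 < ρ ∧ ∀ᶠ n : ℕ in atTop, ∀ σ ∈ typicalMatchings n d,
      ∀ k : ℕ, (k : ℝ) ≤ ρ * n →
      ∀ P : Matrix (IndepSets (matchingGraph σ)) (IndepSets (matchingGraph σ)) ℝ,
        IsReversibleChain P (hardCore (matchingGraph σ) lam) → UpdatesAtMost k P →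
        ENNReal.ofReal (1 / 4 * a ^ n) ≤
          (mixingTime P (hardCore (matchingGraph σ) lam) : ENNReal) := by
  have hlam : 0 < lam := (lamCrit_pos hd).trans hl
  have hd0 : 0 < d := by omega
  obtain ⟨α, β, δ, η, hα, hβ, hαβ, hδ, hη, hδαβ, hmax, hgap⟩ := exists_rate_gap hd hl
  -- Heavy phases weigh at least exp(n(R - η))/2, balanced sets at most exp(n(R - 4η) + O(log n)).
  -- Of the gap 3η, one η gives the base e^η and 2η absorbs the error terms. `ρ` is the half-width
  -- δ/2 of the balanced window.
  refine ⟨Real.exp η, Real.one_lt_exp_iff.2 hη, δ / 2, half_pos hδ, ?_⟩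
  filter_upwards [eventually_log_add_le (11 + 4 * (d : ℝ)) (show 0 < η * δ / 2 by positivity),
    eventually_log_add_le (11 + 4 * (d : ℝ)) (show 0 < 2 * η by positivity),
    eventually_gt_atTop 0] with n hlarge hlarge' hn σ hσ k hk P hP hPk
  set R := rate d lam lam α β with hR
  have hn' : (0 : ℝ) < n := by exact_mod_cast hn
  have hheavy : ∀ s : ℝ, |s| = 1 → Real.exp (n * (R - η)) / 2 ≤
      ∑ p ∈ indepPairs σ with δ / 2 * n < s * ((p.1.card : ℝ) - p.2.card),
        lam ^ (p.1.card + p.2.card) := by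
    intro s hs
    rcases (abs_eq zero_le_one).1 hs with h | h
    · exact exp_le_sum_indepPairs_imbalanced hd0 hn hlam hσ hα hβ hαβ hη hs
        (by rw [h]; linarith) hmax hlarge
    · rw [hR, rate_comm]
      exact exp_le_sum_indepPairs_imbalanced hd0 hn hlam hσ hβ hα (by linarith) hη hs
        (by rw [h]; linarith) (by rw [rate_comm d lam β]; exact hmax) hlarge
  have hlight : ∑ p ∈ indepPairs σ with |(p.1.card : ℝ) - p.2.card| ≤ δ / 2 * n,
      lam ^ (p.1.card + p.2.card) ≤
      Real.exp (n * (R - 4 * η) + (11 + 4 * d) * (Real.log (n + 1) + 1)) := by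
    refine sum_indepPairs_le hd0 hn hlam hσ (fun a b => |(a : ℝ) - b| ≤ δ / 2 * n) (R - 4 * η)
      fun a b hab hT => hgap _ (mem_densities hn hab) ?_
    simp only
    rw [← sub_div, abs_div, abs_of_pos hn', div_le_iff₀ hn']
    refine hT.trans (mul_le_mul_of_nonneg_right (by linarith) hn'.le)
  refine ofReal_le_mixingTime_of_weights hlam (by positivity) hk
    (fun s hs => lt_of_lt_of_le (by positivity) (hheavy s hs)) (by positivity)
    (fun s hs => le_trans ?_ (hheavy s hs)) hP hPk
  refine (mul_le_mul_of_nonneg_left hlight (by positivity)).trans ?_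
  rw [le_div_iff₀ two_pos, ← Real.exp_nat_mul, ← Real.exp_add]
  calc _ = Real.exp (n * η + (n * (R - 4 * η) + (11 + 4 * d) * (Real.log (n + 1) + 1))) *
        Real.exp (Real.log 2) := by rw [Real.exp_log two_pos]
    _ ≤ _ := by
        rw [← Real.exp_add]
        refine Real.exp_le_exp.2 ?_
        linarith

end HardCore

theorem theorem1 (d : ℕ) (hd : 3 ≤ d) :
    ∃ ε : ℝ, 0 < ε ∧ ∀ lam : ℝ,
      HardCore.lamCrit d < lam → lam < HardCore.lamCrit d + ε →
      ∃ a : ℝ, 1 < a ∧ ∃ c : ℝ, 0 < c ∧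
        Tendsto (fun n : ℕ => HardCore.matchingProb n d
          {σ | ENNReal.ofReal (c * a ^ n) ≤
            (HardCore.mixingTime (HardCore.glauber (HardCore.matchingGraph σ) lam)
              (HardCore.hardCore (HardCore.matchingGraph σ) lam) : ENNReal)})
          atTop (𝓝 1) ∧
        ∀ k : ℕ → ℕ, (fun n => (k n : ℝ)) =o[atTop] (fun n => (n : ℝ)) →
          Tendsto (fun n : ℕ => HardCore.matchingProb n d
            {σ | ∀ P : Matrix (HardCore.IndepSets (HardCore.matchingGraph σ))
                  (HardCore.IndepSets (HardCore.matchingGraph σ)) ℝ,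
              HardCore.IsReversibleChain P
                (HardCore.hardCore (HardCore.matchingGraph σ) lam) →
              HardCore.UpdatesAtMost (k n) P →
              ENNReal.ofReal (c * a ^ n) ≤
                (HardCore.mixingTime P
                  (HardCore.hardCore (HardCore.matchingGraph σ) lam) : ENNReal)})
            atTop (𝓝 1) := by
  -- Any positive ε serves: the argument covers every λ > λ_c.
  refine ⟨1, one_pos, fun lam hl _ => ?_⟩
  have hlam : 0 < lam := (HardCore.lamCrit_pos hd).trans hl
  obtain ⟨a, ha, ρ, hρ, hmix⟩ := HardCore.exists_forall_typicalMatchings_mixingTime_ge hd hl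
  refine ⟨a, ha, 1 / 4, by norm_num, HardCore.tendsto_matchingProb_one ?_, fun k hk =>
    HardCore.tendsto_matchingProb_one ?_⟩
  -- Single-site updates fit within ρn once n ≥ 1/ρ; n = 0 is excluded because the Glauber matrix
  -- would vanish.
  · have hone : ∀ᶠ n : ℕ in atTop, 1 / ρ ≤ (n : ℝ) :=
      tendsto_natCast_atTop_atTop.eventually_ge_atTop _
    filter_upwards [hmix, hone, eventually_gt_atTop 0] with n hn hn1 hn0 σ hσ
    rw [div_le_iff₀ hρ, mul_comm] at hn1
    have : Nonempty (Fin n ⊕ Fin n) := ⟨Sum.inl ⟨0, hn0⟩⟩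
    exact hn σ hσ 1 (by exact_mod_cast hn1) _ (HardCore.isReversibleChain_glauber hlam)
      HardCore.updatesAtMost_glauber
  · filter_upwards [hmix, hk.def hρ] with n hn hkn σ hσ P hP hPk
    simp only [Real.norm_natCast] at hkn
    exact hn σ hσ (k n) hkn P hP hPk
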